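/- Let $V$ be a finite dimensional real vector space, $\Lambda\subset V$ a lattice of maximal rank (so $V=\Lambda\otimes\mathbb{R}$), and $\omega$ a non-degenerate skew-symmetric real bilinear form on $V$ with integral values on $\Lambda$. A metric is a symmetric positive definite real bilinear form, and a complex structure on $V$ is an endomorphism $J$ with $J^2=-\mathrm{id}$. (1) Let $b$ be a metric on $V$. There is a unique complex structure $J$ on $V$ such that $b(Jx,Jy)=b(x,y)$ and $\omega(Jx,Jy)=\omega(x,y)$ for all $x,y\in V$, and such that $b_{\omega,J}(x,y):=\omega(x,Jy)$ is a metric. With this $J$ the complex torus $V/\Lambda$ is an abelian variety, i.e. it admits a holomorphic embedding in some projective space $\mathbb{P}^n(\mathbb{C})$, and $$h(x,y)=\omega(x,Jy)+i\,\omega(x,y)$$ is a polarization of it, i.e. a positive definite hermitian form on $(V,J)$ whose imaginary part is integral on $\Lambda$. If $\omega$ is unimodular on $\Lambda$, i.e. $x\mapsto\omega(x,\cdot)$ is a bijection $\Lambda\to\mathrm{Hom}(\Lambda,\mathbb{Z})$, then this polarization is principal, i.e. $x\mapsto \mathrm{Im}\,h(x,\cdot)$ induces an isomorphism from $V/\Lambda$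 to the dual torus $\mathrm{Hom}_{\mathbb{R}}(V,\mathbb{R})/\{\ell : \ell(\Lambda)\subset\mathbb{Z}\}$. (2) Conversely, let $J$ be a complex structure on $V$ that is compatible with $\omega$, i.e. $\omega(Jx,Jy)=\omega(x,y)$ for all $x,y\in V$, and satisfies $\omega(x,Jx)>0$ for all $x\neq0$. Then $\omega$ is a Riemann form for the complex torus $V/\Lambda$: it is skew-symmetric, integral on $\Lambda$ and $J$-invariant, and $b_{\omega,J}(x,y)=\omega(x,Jy)$ is a metric on $V$ for which $J$ is orthogonal. Moreover $J$ is the unique complex structure attached as in (1) to $\omega$ and the metric $b=b_{\omega,J}$. -/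

import Mathlib

open Topology
open scoped LinearAlgebra.Projectivization

/-! ### Linear algebra of a real vector space: metrics, symplectic forms, complex structures -/

section Algebra

variable {V : Type*} [AddCommGroup V] [Module ℝ V]

/-- A (positive definite) metric on a real vector space: a symmetric positive definite
bilinear form. -/
structure IsMetric (b : LinearMap.BilinForm ℝ V) : Prop where
  symm : ∀ x y, b x y = b y x
  pos : ∀ x, x ≠ 0 → 0 < b x x

/-- A symplectic form: a non-degenerate skew-symmetric real bilinear form. -/
structure IsSymplecticForm (ω : LinearMap.BilinForm ℝ V) : Prop where
  skew : ∀ x y, ω x y = -ω y x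
  nondegenerate : ∀ x, (∀ y, ω x y = 0) → x = 0

/-- A complex structure: an endomorphism `J` with `J² = -id`. -/
def IsComplexStructure (J : V →ₗ[ℝ] V) : Prop :=
  ∀ x, J (J x) = -x

/-- The form `b_{ω,J}(x, y) = ω(x, J y)`. -/
def realForm (ω : LinearMap.BilinForm ℝ V) (J : V →ₗ[ℝ] V) : LinearMap.BilinForm ℝ V :=
  ω.compl₂ J

@[simp] theorem realForm_apply (ω : LinearMap.BilinForm ℝ V) (J : V →ₗ[ℝ] V) (x y : V) :
    realForm ω J x y = ω x (J y) := rfl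

/-- The properties that single out the complex structure attached to a metric `b` and a
symplectic form `ω`: `J` is a complex structure preserving `b` and `ω`, and
`(x, y) ↦ ω(x, J y)` is a metric. -/
structure IsAssociatedComplexStructure (b ω : LinearMap.BilinForm ℝ V) (J : V →ₗ[ℝ] V) :
    Prop where
  complex : IsComplexStructure J
  metric_inv : ∀ x y, b (J x) (J y) = b x y
  symplectic_inv : ∀ x y, ω (J x) (J y) = ω x y
  isMetric : IsMetric (realForm ω J)

/-- `ω` is tamed by `J`: `J` is `ω`-symplectic and `ω(x, J x) > 0` for `x ≠ 0`. -/
structure IsTamedBy (ω : LinearMap.BilinForm ℝ V) (J : V →ₗ[ℝ] V) : Prop where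
  compatible : ∀ x y, ω (J x) (J y) = ω x y
  pos : ∀ x, x ≠ 0 → 0 < ω x (J x)

/-- The complex valued real bilinear form `h(x, y) = ω(x, J y) + i ω(x, y)`. -/
noncomputable def complexForm (ω : LinearMap.BilinForm ℝ V) (J : V →ₗ[ℝ] V) :
    V →ₗ[ℝ] V →ₗ[ℝ] ℂ :=
  (realForm ω J).compr₂ Complex.ofRealCLM.toLinearMap +
    Complex.I • ω.compr₂ Complex.ofRealCLM.toLinearMap

@[simp] theorem complexForm_apply (ω : LinearMap.BilinForm ℝ V) (J : V →ₗ[ℝ] V) (x y : V) :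
    complexForm ω J x y = (ω x (J y) : ℂ) + Complex.I * (ω x y : ℂ) := rfl

/-- The real part of a complex valued real bilinear form. -/
noncomputable def rePart (h : V →ₗ[ℝ] V →ₗ[ℝ] ℂ) : LinearMap.BilinForm ℝ V :=
  h.compr₂ Complex.reLm

/-- The imaginary part of a complex valued real bilinear form. -/
noncomputable def imPart (h : V →ₗ[ℝ] V →ₗ[ℝ] ℂ) : LinearMap.BilinForm ℝ V :=
  h.compr₂ Complex.imLm

@[simp] theorem rePart_apply (h : V →ₗ[ℝ] V →ₗ[ℝ] ℂ) (x y : V) :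
    rePart h x y = (h x y).re := rfl

@[simp] theorem imPart_apply (h : V →ₗ[ℝ] V →ₗ[ℝ] ℂ) (x y : V) :
    imPart h x y = (h x y).im := rfl

/-- A (positive definite) hermitian metric on `(V, J)`, in terms of its real and imaginary
parts. -/
structure IsHermitianMetric (J : V →ₗ[ℝ] V) (h : V →ₗ[ℝ] V →ₗ[ℝ] ℂ) : Prop where
  inv : ∀ x y, h (J x) (J y) = h x y
  re_isMetric : IsMetric (rePart h)
  im_isSymplectic : IsSymplecticForm (imPart h)
  im_eq : ∀ x y, imPart h x y = rePart h (J x) y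

/-- A hermitian metric is complex linear in the second variable. -/
theorem IsHermitianMetric.map_J_right {J : V →ₗ[ℝ] V} {h : V →ₗ[ℝ] V →ₗ[ℝ] ℂ}
    (H : IsHermitianMetric J h) (hJ : IsComplexStructure J) (x y : V) :
    h x (J y) = Complex.I * h x y := by
  have h1 := H.im_eq x y
  have h2 := H.im_eq x (J y)
  have h3 := congrArg Complex.re (H.inv x y)
  have h4 := congrArg Complex.re (H.inv x (J y))
  rw [hJ y] at h4
  simp only [imPart_apply, rePart_apply, map_neg, Complex.neg_re] at h1 h2 h3 h4
  apply Complex.ext <;> simp <;> linarith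

/-- A hermitian metric is conjugate symmetric. -/
theorem IsHermitianMetric.conj_symm {J : V →ₗ[ℝ] V} {h : V →ₗ[ℝ] V →ₗ[ℝ] ℂ}
    (H : IsHermitianMetric J h) (x y : V) :
    h y x = (starRingEnd ℂ) (h x y) := by
  apply Complex.ext
  · simpa using H.re_isMetric.symm y x
  · simpa using H.im_isSymplectic.skew y x

/-! ### Lattices and integral forms -/

/-- The bilinear form `ω` takes integral values on `Λ`. -/
def IsIntegralOn (Λ : Submodule ℤ V) (ω : LinearMap.BilinForm ℝ V) : Prop :=
  ∀ x ∈ Λ, ∀ y ∈ Λ, ∃ n : ℤ, ω x y = n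

/-- `ω` is unimodular on `Λ`: it is integral, and every integral linear functional on `Λ` is
`y ↦ ω(x, y)` for a unique `x ∈ Λ`. -/
def IsUnimodularOn (Λ : Submodule ℤ V) (ω : LinearMap.BilinForm ℝ V) : Prop :=
  IsIntegralOn Λ ω ∧
    ∀ f : Λ →ₗ[ℤ] ℤ, ∃! x : Λ, ∀ y : Λ, ω (x : V) (y : V) = (f y : ℝ)

/-- `ω` is a Riemann form for the complex torus `(V, J) / Λ`. -/
structure IsRiemannForm (Λ : Submodule ℤ V) (J : V →ₗ[ℝ] V) (ω : LinearMap.BilinForm ℝ V) :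
    Prop where
  skew : ∀ x y, ω x y = -ω y x
  integral : IsIntegralOn Λ ω
  symplectic_inv : ∀ x y, ω (J x) (J y) = ω x y
  isMetric : IsMetric (realForm ω J)
  orthogonal : ∀ x y, realForm ω J (J x) (J y) = realForm ω J x y

/-- `h` is a polarization of the complex torus `(V, J) / Λ`: a positive definite hermitian
form whose imaginary part is integral on `Λ`. -/
structure IsPolarization (Λ : Submodule ℤ V) (J : V →ₗ[ℝ] V) (h : V →ₗ[ℝ] V →ₗ[ℝ] ℂ) :
    Prop where
  complex : IsComplexStructure J
  hermitian : IsHermitianMetric J h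
  integral : IsIntegralOn Λ (imPart h)

/-- The dual lattice: the real functionals on `V` with integral values on `Λ`. -/
def dualLattice (Λ : Submodule ℤ V) : Submodule ℤ (Module.Dual ℝ V) where
  carrier := {l | ∀ x ∈ Λ, ∃ n : ℤ, l x = n}
  add_mem' := by
    intro l m hl hm x hx
    obtain ⟨a, ha⟩ := hl x hx
    obtain ⟨c, hc⟩ := hm x hx
    exact ⟨a + c, by simp [ha, hc]⟩
  zero_mem' := fun _ _ => ⟨0, by simp⟩
  smul_mem' := by
    intro k l hl x hx
    obtain ⟨a, ha⟩ := hl x hx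
    exact ⟨k * a, by simp [ha]⟩

/-- The dual torus of `V / Λ`. The usual dual torus is the space of conjugate linear
functionals modulo those whose imaginary part is integral on `Λ`; taking imaginary parts
identifies it with the quotient below. -/
abbrev DualTorus (Λ : Submodule ℤ V) : Type _ := Module.Dual ℝ V ⧸ dualLattice Λ

/-- The polarization `h` of `V / Λ` is principal: the homomorphism from the torus to its dual
torus induced by `x ↦ Im h(x, ·)` is (well defined and) an isomorphism. -/
def IsPrincipal (Λ : Submodule ℤ V) (h : V →ₗ[ℝ] V →ₗ[ℝ] ℂ) : Prop :=
  ∃ φ : (V ⧸ Λ) ≃+ DualTorus Λ,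
    ∀ x : V, φ (Submodule.Quotient.mk x) = Submodule.Quotient.mk (imPart h x)

end Algebra

/-! ### Complex tori and abelian varieties

Here `V` is a finite dimensional real normed space; only its topology matters. The complex torus
attached to a lattice `Λ` and a complex structure `J` is `V ⧸ Λ`, and its holomorphic charts are
the local inverses of `V → V ⧸ Λ`, where `V` is regarded as a complex vector space through `J`. -/

section Torus

variable {V : Type*} [NormedAddCommGroup V] [NormedSpace ℝ V]

/-- `F` is holomorphic on the open set `U` with respect to the complex structure `J`: it is real
differentiable and its derivative is complex linear, `dF ∘ J = i dF`. -/
def IsHolomorphicOn (J : V →ₗ[ℝ] V) {m : ℕ} (F : V → Fin m → ℂ) (U : Set V) : Prop :=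
  ∀ w ∈ U, DifferentiableAt ℝ F w ∧
    ∀ v, fderiv ℝ F w (J v) = Complex.I • fderiv ℝ F w v

/-- `φ` is a holomorphic embedding of the complex torus `(V, J) / Λ` in projective `n`-space:
it is injective, and near each point `z` it is given in homogeneous coordinates by a
nowhere vanishing holomorphic `F`, in such a way that the differential of `φ` at `z` is
injective: `dF(v)` is proportional to `F(z)` only for `v = 0`. (The torus of a lattice is
compact, so an injective immersion is an embedding.) -/
structure IsProjectiveEmbedding (Λ : Submodule ℤ V) (J : V →ₗ[ℝ] V) (n : ℕ)
    (φ : V ⧸ Λ → ℙ ℂ (Fin (n + 1) → ℂ)) : Prop where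
  injective : Function.Injective φ
  immersion : ∀ z : V, ∃ U : Set V, IsOpen U ∧ z ∈ U ∧ ∃ F : V → Fin (n + 1) → ℂ,
    IsHolomorphicOn J F U ∧
    (∀ w ∈ U, ∃ hw : F w ≠ 0, φ (Submodule.Quotient.mk w) = Projectivization.mk ℂ (F w) hw) ∧
    ∀ v : V, (∃ c : ℂ, fderiv ℝ F z v = c • F z) → v = 0

/-- The torus `V / Λ` with the complex structure `J` is an abelian variety: a complex torus
that is a projective variety, that is, embeds holomorphically in some projective space. -/
def IsAbelianVariety (Λ : Submodule ℤ V) (J : V →ₗ[ℝ] V) : Prop :=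
  IsComplexStructure J ∧
    ∃ (n : ℕ) (φ : V ⧸ Λ → ℙ ℂ (Fin (n + 1) → ℂ)), IsProjectiveEmbedding Λ J n φ

end Torus

/-! The linear algebra is polar decomposition. Writing `ω = b(A ·, ·)` with `A` skew-adjoint and
invertible, an associated complex structure `J` commutes with `A`, and `-AJ` is then a positive
definite square root of `-A²`. Such a square root exists and is unique
(`IsMetric.exists_sqrt`, `IsMetric.sqrt_unique`), which gives existence and uniqueness of `J`
(`existsUnique_isAssociatedComplexStructure`).

The projective embedding is constructed with theta functions, without any dimension count. Let `H`
be the hermitian form with `Im H = ω`. The entire function `exp (2πm H(a, z))` has norm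
`exp (-πm |z - a|²)` up to a constant, where `|x|² = H(x, x)`, for the hermitian metric
`exp (-2πm H(z, z))` of the line bundle of level `m`. It is a Gaussian peak at `a`, and its Poincaré
series `coherentTheta` is a theta function of level `m`. As `m → ∞` the term at
the peak dominates. The peaks at `z` and `w` therefore separate `z` from `w` when `z - w ∉ Λ`
(`IsCoercivePolarization.exists_isTheta_separating`), and the peaks at `z` and `z + ε v` detect the
tangent vector `v` at `z` (`IsCoercivePolarization.exists_isTheta_immersive`).

The level needed depends on `z`, `w`, `v`. Replacing a family `T` by the products `f ^ n * g`
multiplies its level by `n + 1` and keeps all these properties, so compactness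
(`exists_isThetaFamily_of_isCompact`) yields a finite family of a single level that is an immersion
everywhere. An immersion is injective near the diagonal
(`IsThetaFamily.eventually_eq_of_proportional`), and a second use of compactness, on pairs of
points, yields a finite family that is also injective modulo `Λ`. -/

/-! ### Square roots of positive operators and the associated complex structure -/

section LinearAlgebra

/-- The fourth root of a positive definite symmetric operator is a polynomial in the operator:
interpolate `t ↦ t ^ (1/4)` at its eigenvalues. Its square is a square root whose positivity is
evident. -/
theorem exists_aeval_pow_four_eq {E : Type*} [NormedAddCommGroup E] [InnerProductSpace ℝ E]
    [FiniteDimensional ℝ E] {B : E →ₗ[ℝ] E} (hB : B.IsSymmetric)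
    (hpos : ∀ x, x ≠ 0 → 0 < inner ℝ x (B x)) :
    ∃ q : Polynomial ℝ, (Polynomial.aeval B q) ^ 4 = B := by
  classical
  set e := hB.eigenvectorBasis rfl
  set μ := hB.eigenvalues rfl
  have hμ : ∀ i, 0 ≤ μ i := fun i ↦
    eigenvalue_nonneg_of_nonneg (hB.hasEigenvalue_eigenvalues rfl i) fun x ↦ by
      rcases eq_or_ne x 0 with rfl | hx
      · simp
      · exact (hpos x hx).le
  refine ⟨Lagrange.interpolate (Finset.univ.image μ) id fun t ↦ t ^ (1 / 4 : ℝ), ?_⟩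
  refine e.toBasis.ext fun i ↦ ?_
  have hi : B (e i) = μ i • e i := hB.apply_eigenvectorBasis rfl i
  have key := Module.End.aeval_apply_of_hasEigenvector (f := B)
    (p := (Lagrange.interpolate (Finset.univ.image μ) id fun t ↦ t ^ (1 / 4 : ℝ)) ^ 4)
    (hB.hasEigenvector_eigenvectorBasis rfl i)
  rw [map_pow] at key
  have hv := Lagrange.eval_interpolate_at_node (s := Finset.univ.image μ) (v := id)
    (fun t : ℝ ↦ t ^ (1 / 4 : ℝ)) Function.injective_id.injOn
    (Finset.mem_image_of_mem μ (Finset.mem_univ i))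
  simp only [id] at hv
  simp only [OrthonormalBasis.coe_toBasis]
  refine key.trans ?_
  rw [hi, Polynomial.eval_pow]
  congr 1
  refine (congrArg (· ^ 4) hv).trans ?_
  rw [← Real.rpow_natCast, ← Real.rpow_mul (hμ i)]
  norm_num

variable {V : Type*} [AddCommGroup V] [Module ℝ V]

theorem IsMetric.eq_zero_of_forall {b : LinearMap.BilinForm ℝ V} (hb : IsMetric b) {x : V}
    (h : ∀ y, b x y = 0) : x = 0 := by
  by_contra hx
  exact (hb.pos x hx).ne' (h x)

theorem IsMetric.nondegenerate {b : LinearMap.BilinForm ℝ V} (hb : IsMetric b) :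
    b.Nondegenerate :=
  ⟨fun _ h ↦ hb.eq_zero_of_forall h, fun _ h ↦ hb.eq_zero_of_forall fun y ↦ by
    rw [hb.symm, h]⟩

/-- A positive definite symmetric operator has a positive definite symmetric square root, which
commutes with everything the operator commutes with. -/
theorem IsMetric.exists_sqrt [FiniteDimensional ℝ V] {b : LinearMap.BilinForm ℝ V}
    (hb : IsMetric b) {B : Module.End ℝ V} (hB : ∀ x y, b (B x) y = b x (B y))
    (hpos : ∀ x, x ≠ 0 → 0 < b x (B x)) :
    ∃ P : Module.End ℝ V, P * P = B ∧ (∀ x y, b (P x) y = b x (P y)) ∧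
      (∀ x, x ≠ 0 → 0 < b x (P x)) ∧ ∀ C, Commute C B → Commute C P := by
  let core : InnerProductSpace.Core ℝ V :=
    { inner := fun x y ↦ b x y
      conj_inner_symm := fun x y ↦ hb.symm y x
      re_inner_nonneg := fun x ↦ by
        rcases eq_or_ne x 0 with rfl | hx
        · simp
        · exact (hb.pos x hx).le
      add_left := fun x y z ↦ by simp
      smul_left := fun x y r ↦ by simp
      definite := fun x h ↦ by
        by_contra hx
        exact (hb.pos x hx).ne' h }
  let : NormedAddCommGroup V := core.toNormedAddCommGroup
  let : InnerProductSpace ℝ V := InnerProductSpace.ofCore core.toCore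
  obtain ⟨q, hq⟩ := exists_aeval_pow_four_eq (E := V) (B := B) (fun x y ↦ hB x y) hpos
  set Q : Module.End ℝ V := Polynomial.aeval B q with hQ
  have hQs : ∀ x y, b (Q x) y = b x (Q y) := by
    rw [hQ]
    clear hq hQ Q
    induction q using Polynomial.induction_on' with
    | add p r hp hr => intro x y; simp [hp, hr]
    | monomial n a =>
      intro x y
      have : ∀ n : ℕ, ∀ x y, b ((B ^ n) x) y = b x ((B ^ n) y) := by
        intro n
        induction n with
        | zero => simp
        | succ n ih => intro x y; rw [pow_succ', Module.End.mul_apply, hB, ih,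
            ← Module.End.mul_apply, ← pow_succ, pow_succ']
      simp [Polynomial.aeval_monomial, this]
  have hQ0 : ∀ x, x ≠ 0 → Q x ≠ 0 := by
    intro x hx h
    have h4 : B x = 0 := by
      rw [← hq, pow_succ, Module.End.mul_apply, h, map_zero]
    exact (hpos x hx).ne' (by rw [h4, map_zero])
  refine ⟨Q * Q, by rw [← hq]; noncomm_ring, fun x y ↦ by simp [hQs], fun x hx ↦ ?_,
    fun C hC ↦ ?_⟩
  · rw [Module.End.mul_apply, ← hQs]
    exact hb.pos _ (hQ0 x hx)
  · have : Commute C Q := by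
      rw [hQ, Polynomial.aeval_eq_sum_range]
      exact Commute.sum_right _ _ _ fun i _ ↦ (hC.pow_right i).smul_right _
    exact this.mul_right this

/-- Positive definite symmetric square roots are unique. -/
theorem IsMetric.sqrt_unique {b : LinearMap.BilinForm ℝ V} {P Q : Module.End ℝ V}
    (hP : ∀ x, x ≠ 0 → 0 < b x (P x)) (hQ : ∀ x, x ≠ 0 → 0 < b x (Q x)) (h : P * P = Q * Q)
    (hPQ : Commute P Q) : P = Q := by
  ext x
  by_contra hne
  have h1 : (P + Q) ((P - Q) x) = 0 := by
    rw [← Module.End.mul_apply, show (P + Q) * (P - Q) = 0 by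
      rw [add_mul, mul_sub, mul_sub, h, hPQ.eq]; abel, LinearMap.zero_apply]
  have h2 : (P - Q) x ≠ 0 := fun h0 ↦ hne (sub_eq_zero.mp h0)
  have h3 := add_pos (hP _ h2) (hQ _ h2)
  rw [← map_add, ← LinearMap.add_apply, h1, map_zero] at h3
  exact h3.false

theorem IsMetric.ext_end {b : LinearMap.BilinForm ℝ V} (hb : IsMetric b) {S T : Module.End ℝ V}
    (h : ∀ x y, b (S x) y = b (T x) y) : S = T := by
  ext x
  refine sub_eq_zero.mp (hb.eq_zero_of_forall fun y ↦ ?_)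
  rw [map_sub, LinearMap.sub_apply, h, sub_self]

variable {b ω : LinearMap.BilinForm ℝ V} {A : Module.End ℝ V}

/-- If `ω = b(A ·, ·)`, an associated complex structure commutes with `A`. -/
theorem IsAssociatedComplexStructure.commute {J : V →ₗ[ℝ] V} (hb : IsMetric b)
    (hA : ∀ x y, b (A x) y = ω x y) (hJ : IsAssociatedComplexStructure b ω J) :
    A * J = J * A := by
  refine hb.ext_end fun x y ↦ ?_
  have hy : y = J (-J y) := by rw [map_neg, hJ.complex, neg_neg]
  rw [hy, Module.End.mul_apply, Module.End.mul_apply, hA, hJ.symplectic_inv, hJ.metric_inv, hA]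

/-- If `ω = b(A ·, ·)`, then `-AJ` is a square root of `-A²`. -/
theorem IsAssociatedComplexStructure.mul_self {J : V →ₗ[ℝ] V} (hb : IsMetric b)
    (hA : ∀ x y, b (A x) y = ω x y) (hJ : IsAssociatedComplexStructure b ω J) :
    (-(A * J)) * (-(A * J)) = -(A * A) := by
  have hJJ : J * J = (-1 : Module.End ℝ V) := by ext x; simpa using hJ.complex x
  have h : A * J * (A * J) = A * A * (J * J) := by
    rw [mul_assoc, ← mul_assoc J, ← hJ.commute hb hA]; noncomm_ring
  rw [neg_mul_neg, h, hJJ, mul_neg, mul_one]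

theorem IsMetric.apply_eq_neg_apply (hb : IsMetric b) (hω : IsSymplecticForm ω)
    (hA : ∀ x y, b (A x) y = ω x y) (x y : V) : b (A x) y = -b x (A y) := by
  rw [hA, hω.skew, hb.symm, hA]

/-- A metric and a symplectic form determine a unique complex structure: if `ω = b(A ·, ·)`, it is
the orthogonal part `A (-A²)^(-1/2)` of the polar decomposition of `A`. -/
theorem existsUnique_isAssociatedComplexStructure [FiniteDimensional ℝ V] (hb : IsMetric b)
    (hω : IsSymplecticForm ω) : ∃! J : V →ₗ[ℝ] V, IsAssociatedComplexStructure b ω J := by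
  obtain ⟨A, hA⟩ : ∃ A : Module.End ℝ V, ∀ x y, b (A x) y = ω x y :=
    ⟨ω.symmCompOfNondegenerate b hb.nondegenerate, fun x y ↦ by simp⟩
  have hsk := hb.apply_eq_neg_apply hω hA
  have hA0 : ∀ x, A x = 0 → x = 0 := fun x hx ↦
    hω.nondegenerate x fun y ↦ by rw [← hA, hx, map_zero, LinearMap.zero_apply]
  obtain ⟨P, hPP, hPs, hPpos, hPc⟩ := hb.exists_sqrt (B := -(A * A))
    (fun x y ↦ by simp [hsk]) (fun x hx ↦ by
      have := hb.pos (A x) fun h ↦ hx (hA0 x h)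
      rw [hsk] at this
      simpa using this)
  have hAP : A * P = P * A := (hPc A ((Commute.refl A).mul_right (Commute.refl A)).neg_right).eq
  refine existsUnique_of_exists_of_unique ?_ fun J₁ J₂ h₁ h₂ ↦ ?_
  · have hPinj : Function.Injective P := by
      rw [injective_iff_map_eq_zero]
      intro x hx
      by_contra h0
      exact (hPpos x h0).ne' (by rw [hx, map_zero])
    obtain ⟨R, hPR, hRP⟩ := (isUnit_iff_exists (x := P)).mp
      ((Module.End.isUnit_iff P).mpr ⟨hPinj, LinearMap.injective_iff_surjective.mp hPinj⟩)
    have hAR : A * R = R * A := by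
      calc A * R = R * P * A * R := by rw [hRP, one_mul]
        _ = R * (A * P) * R := by rw [hAP]; noncomm_ring
        _ = R * A * (P * R) := by noncomm_ring
        _ = R * A := by rw [hPR, mul_one]
    have hAA : A * A = -(P * P) := by rw [hPP, neg_neg]
    have hAAR : A * (A * R) = -P := by
      rw [← mul_assoc, hAA, neg_mul, mul_assoc, hPR, mul_one]
    have hJJ : (A * R) * (A * R) = -1 := by
      calc (A * R) * (A * R) = R * (A * (A * R)) := by rw [hAR]; noncomm_ring
        _ = -1 := by rw [hAAR, mul_neg, hRP]
    have hform : ∀ x y, ω x ((A * R) y) = b x (P y) := fun x y ↦ by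
      rw [← hA, hsk, ← Module.End.mul_apply, hAAR, LinearMap.neg_apply, map_neg, neg_neg]
    have hJs : ∀ x y, b ((A * R) x) y = -b x ((A * R) y) := fun x y ↦ by
      have h1 : ∀ x y, b (R x) y = b x (R y) := fun x y ↦ by
        conv_lhs => rw [show y = P (R y) by rw [← Module.End.mul_apply, hPR]; rfl]
        rw [← hPs, ← Module.End.mul_apply P, hPR]; rfl
      rw [Module.End.mul_apply, hsk, h1, hAR, Module.End.mul_apply]
    have hcx : IsComplexStructure (A * R) := fun x ↦ by
      rw [← Module.End.mul_apply, hJJ]; rfl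
    have hmet : ∀ x y, b ((A * R) x) ((A * R) y) = b x y := fun x y ↦ by
      rw [hJs, hcx, map_neg, neg_neg]
    refine ⟨A * R, hcx, hmet, fun x y ↦ ?_, fun x y ↦ ?_, fun x hx ↦ ?_⟩
    · rw [← hA, ← hA, ← Module.End.mul_apply, show A * (A * R) = A * R * A by
        rw [mul_assoc, ← hAR], Module.End.mul_apply, hmet]
    · rw [realForm_apply, realForm_apply, hform, hform, ← hPs, hb.symm]
    · rw [realForm_apply, hform]
      exact hPpos x hx
  · have key : ∀ J : V →ₗ[ℝ] V, IsAssociatedComplexStructure b ω J → -(A * J) = P := by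
      intro J hJ
      have hmul := hJ.mul_self hb hA
      refine IsMetric.sqrt_unique (b := b) (fun x hx ↦ ?_) hPpos (hmul.trans hPP.symm) ?_
      · have := hJ.isMetric.pos x hx
        rw [realForm_apply, ← hA, hsk] at this
        simpa using this
      · refine hPc _ ?_
        rw [← hmul]
        exact (Commute.refl _).mul_right (Commute.refl _)
    have h := neg_injective ((key J₁ h₁).trans (key J₂ h₂).symm)
    ext x
    exact sub_eq_zero.mp (hA0 _ (by
      rw [map_sub, sub_eq_zero, ← Module.End.mul_apply, h, Module.End.mul_apply]))

theorem imPart_complexForm (ω : LinearMap.BilinForm ℝ V) (J : V →ₗ[ℝ] V) :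
    imPart (complexForm ω J) = ω := by
  ext x y
  simp

theorem rePart_complexForm (ω : LinearMap.BilinForm ℝ V) (J : V →ₗ[ℝ] V) :
    rePart (complexForm ω J) = realForm ω J := by
  ext x y
  simp

theorem IsAssociatedComplexStructure.isHermitianMetric {J : V →ₗ[ℝ] V} (hω : IsSymplecticForm ω)
    (hJ : IsAssociatedComplexStructure b ω J) : IsHermitianMetric J (complexForm ω J) where
  inv x y := by simp [hJ.symplectic_inv]
  re_isMetric := by rw [rePart_complexForm]; exact hJ.isMetric
  im_isSymplectic := by rw [imPart_complexForm]; exact hω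
  im_eq x y := by rw [imPart_complexForm, rePart_complexForm, realForm_apply, hJ.symplectic_inv]

/-- A complex structure taming `ω` is associated with `ω` and the metric `ω(·, J ·)`. -/
theorem IsTamedBy.isAssociatedComplexStructure {J : V →ₗ[ℝ] V} (hω : IsSymplecticForm ω)
    (hJ : IsComplexStructure J) (ht : IsTamedBy ω J) :
    IsAssociatedComplexStructure (realForm ω J) ω J where
  complex := hJ
  metric_inv x y := by simp [ht.compatible]
  symplectic_inv := ht.compatible
  isMetric := ⟨fun x y ↦ by
    rw [realForm_apply, realForm_apply, ← ht.compatible, hJ, map_neg, hω.skew, neg_neg], ht.pos⟩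

end LinearAlgebra

/-! ### Unimodular forms and principal polarizations -/

/-- The isomorphism `V ≃ Hom(V, ℝ)` given by a non-degenerate form carries `Λ` onto the dual
lattice if the form is unimodular on `Λ`. -/
theorem isPrincipal_of_isUnimodularOn {V : Type*} [NormedAddCommGroup V] [NormedSpace ℝ V]
    [FiniteDimensional ℝ V] {Λ : Submodule ℤ V} [DiscreteTopology Λ] [IsZLattice ℝ Λ]
    {ω : LinearMap.BilinForm ℝ V} (hω : IsSymplecticForm ω) (hun : IsUnimodularOn Λ ω)
    {h : V →ₗ[ℝ] V →ₗ[ℝ] ℂ} (hh : imPart h = ω) : IsPrincipal Λ h := by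
  have hnd : ω.Nondegenerate :=
    ⟨fun x hx ↦ hω.nondegenerate x hx, fun x hx ↦ hω.nondegenerate x fun y ↦ by
      rw [hω.skew, hx, neg_zero]⟩
  let e : V ≃ₗ[ℤ] Module.Dual ℝ V := (LinearMap.BilinForm.toDual ω hnd).restrictScalars ℤ
  have he : ∀ x, e x = ω x := fun x ↦ by
    ext y; exact LinearMap.BilinForm.toDual_def hnd
  have hmap : Λ.map (e : V →ₗ[ℤ] Module.Dual ℝ V) = dualLattice Λ := by
    ext l
    constructor
    · rintro ⟨x, hx, rfl⟩ y hy
      obtain ⟨n, hn⟩ := hun.1 x hx y hy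
      exact ⟨n, by rw [← hn]; exact congrArg (· y) (he x)⟩
    · intro hl
      choose f hf using fun y : Λ ↦ hl y y.2
      let F : Λ →ₗ[ℤ] ℤ :=
        { toFun := f
          map_add' := fun x y ↦ by
            have : (f (x + y) : ℝ) = f x + f y := by rw [← hf, ← hf, ← hf]; simp
            exact_mod_cast this
          map_smul' := fun n x ↦ by
            have : (f (n • x) : ℝ) = n * f x := by rw [← hf, ← hf]; simp
            simpa using (by exact_mod_cast this : f (n • x) = n * f x) }
      obtain ⟨x, hx, -⟩ := hun.2 F
      refine ⟨x, x.2, (he x).trans ?_⟩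
      have hspan : Submodule.span ℝ (Λ : Set V) = ⊤ := IsZLattice.span_top
      exact LinearMap.ext_on hspan fun y hy ↦ (hx ⟨y, hy⟩).trans (hf ⟨y, hy⟩).symm
  refine ⟨(Submodule.Quotient.equiv Λ (dualLattice Λ) e hmap).toAddEquiv, fun x ↦ ?_⟩
  rw [hh, ← he]
  rfl

/-! ### Gaussian sums over a lattice -/

section Sums

/-- Gaussian sums over a lattice converge, with an arbitrary linear term in the exponent. -/
theorem summable_one_add_norm_mul_exp {V : Type*} [NormedAddCommGroup V] [NormedSpace ℝ V]
    [FiniteDimensional ℝ V] (Λ : Submodule ℤ V) [DiscreteTopology Λ] (C : ℝ) {c : ℝ} (hc : 0 < c) :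
    Summable fun l : Λ ↦ (1 + ‖l‖) * Real.exp (C * ‖l‖ - c * ‖l‖ ^ 2) := by
  classical
  set n := Module.finrank ℤ Λ + 1
  have hs := (ZLattice.summable_norm_pow_inv Λ n (Nat.lt_succ_self _)).mul_left
    (Real.exp ((C + 2) ^ 2 / (4 * c)) * n.factorial)
  refine Summable.of_nonneg_of_le (fun l ↦ by positivity) (fun l ↦ ?_)
    (hs.add (summable_of_hasFiniteSupport (f := fun l : Λ ↦ if l = 0 then (1 : ℝ) else 0)
      ((Set.finite_singleton 0).subset fun l hl ↦ by simpa using hl)))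
  rcases eq_or_ne l 0 with rfl | hl
  · simp [n]
  have hx : 0 < ‖l‖ := norm_pos_iff.mpr hl
  rw [if_neg hl, add_zero]
  generalize ‖l‖ = x at hx
  have h1 : 1 + x ≤ Real.exp x := by linarith [Real.add_one_le_exp x]
  -- complete the square in the exponent
  have h2 : x + (C * x - c * x ^ 2) ≤ (C + 2) ^ 2 / (4 * c) - x := by
    have h : (C + 2) ^ 2 / (4 * c) - x - (x + (C * x - c * x ^ 2)) =
        (2 * c * x - (C + 2)) ^ 2 / (4 * c) := by
      field_simp
      ring
    have : 0 ≤ (2 * c * x - (C + 2)) ^ 2 / (4 * c) := by positivity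
    linarith
  have h3 : x ^ n / n.factorial ≤ Real.exp x := Real.pow_div_factorial_le_exp x hx.le n
  have h4 : Real.exp (-x) ≤ n.factorial * x⁻¹ ^ n := by
    rw [Real.exp_neg, inv_pow]
    have := inv_anti₀ (by positivity) h3
    rwa [inv_div, div_eq_mul_inv] at this
  calc (1 + x) * Real.exp (C * x - c * x ^ 2)
      ≤ Real.exp x * Real.exp (C * x - c * x ^ 2) := by gcongr
    _ ≤ Real.exp ((C + 2) ^ 2 / (4 * c)) * Real.exp (-x) := by
      rw [← Real.exp_add, ← Real.exp_add]
      exact Real.exp_le_exp.mpr (by linarith)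
    _ ≤ _ := by
      rw [mul_assoc]
      gcongr

variable {ι : Type*} {p q : ι → ℂ}

theorem norm_mul_exp_natCast_mul_le {p q : ℂ} (hq : q.re ≤ 0) {m : ℕ} (hm : 0 < m) :
    ‖p * Complex.exp (m * q)‖ ≤ ‖p‖ * Real.exp q.re := by
  rw [norm_mul, Complex.norm_exp]
  have h1 : (1 : ℝ) ≤ m := by exact_mod_cast hm
  have : ((m : ℂ) * q).re ≤ q.re := by
    simp only [Complex.mul_re, Complex.natCast_re, Complex.natCast_im, zero_mul, sub_zero]
    nlinarith
  gcongr

theorem tendsto_mul_exp_natCast_mul {p q : ℂ} (hq : q.re < 0) :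
    Filter.Tendsto (fun m : ℕ ↦ p * Complex.exp (m * q)) Filter.atTop (𝓝 0) := by
  have h : ∀ m : ℕ, Complex.exp (m * q) = Complex.exp q ^ m := fun m ↦ by
    rw [← Complex.exp_nat_mul]
  simp_rw [h]
  have := tendsto_pow_atTop_nhds_zero_of_norm_lt_one (x := Complex.exp q)
    (by rw [Complex.norm_exp]; simpa using hq)
  simpa using this.const_mul p

/-- Laplace's method for a sum whose exponents all have negative real part. -/
theorem tendsto_tsum_mul_exp_zero (hs : Summable fun i ↦ ‖p i‖ * Real.exp (q i).re)
    (hq : ∀ i, (q i).re < 0) :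
    Filter.Tendsto (fun m : ℕ ↦ ∑' i, p i * Complex.exp (m * q i)) Filter.atTop (𝓝 0) := by
  have := tendsto_tsum_of_dominated_convergence (𝓕 := Filter.atTop) (g := fun _ : ι ↦ (0 : ℂ))
    (f := fun (m : ℕ) i ↦ p i * Complex.exp (m * q i)) hs
    (fun i ↦ tendsto_mul_exp_natCast_mul (hq i))
    ((Filter.eventually_gt_atTop 0).mono fun m hm i ↦
      norm_mul_exp_natCast_mul_le (hq i).le hm)
  simpa using this

/-- Laplace's method for a sum with one dominant term. -/
theorem tendsto_tsum_mul_exp_apply (hs : Summable fun i ↦ ‖p i‖ * Real.exp (q i).re) (i₀ : ι)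
    (h₀ : q i₀ = 0) (hq : ∀ i, i ≠ i₀ → (q i).re < 0) :
    Filter.Tendsto (fun m : ℕ ↦ ∑' i, p i * Complex.exp (m * q i)) Filter.atTop (𝓝 (p i₀)) := by
  classical
  have := tendsto_tsum_of_dominated_convergence (𝓕 := Filter.atTop)
    (g := fun i ↦ if i = i₀ then p i₀ else 0)
    (f := fun (m : ℕ) i ↦ p i * Complex.exp (m * q i)) hs
    (fun i ↦ by
      rcases eq_or_ne i i₀ with rfl | hi
      · simp [h₀]
      · simpa [hi] using tendsto_mul_exp_natCast_mul (hq i hi))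
    ((Filter.eventually_gt_atTop 0).mono fun m hm i ↦ by
      refine norm_mul_exp_natCast_mul_le ?_ hm
      rcases eq_or_ne i i₀ with rfl | hi
      · simp [h₀]
      · exact (hq i hi).le)
  simpa using this

end Sums

/-! ### Theta functions -/

section Theta

variable {V : Type*} [NormedAddCommGroup V] [NormedSpace ℝ V]

/-- A positive definite hermitian form on `(V, J)`, complex linear in the second variable, whose
imaginary part is integral on `Λ`; as a continuous bilinear map with an explicit lower bound. -/
structure IsCoercivePolarization (Λ : Submodule ℤ V) (J : V →ₗ[ℝ] V) (H : V →L[ℝ] V →L[ℝ] ℂ) :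
    Prop where
  conj_symm : ∀ x y, H y x = (starRingEnd ℂ) (H x y)
  map_J : ∀ x y, H x (J y) = Complex.I * H x y
  coercive : ∃ c > 0, ∀ x, c * ‖x‖ ^ 2 ≤ (H x x).re
  integral : ∀ x ∈ Λ, ∀ y ∈ Λ, ∃ n : ℤ, (H x y).im = n

/-- The factor of automorphy of level `m`. It belongs to the `2m`-th power of a line bundle whose
first Chern class is, up to sign conventions, `Im H`; for an even power no semicharacter is
needed. -/
noncomputable def thetaFactor (H : V →L[ℝ] V →L[ℝ] ℂ) (m : ℕ) (l z : V) : ℂ :=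
  Complex.exp (2 * Real.pi * m * (H l z + H l l / 2))

/-- Theta functions of level `m`: `C¹` functions on `V`, holomorphic for `J`, with factor of
automorphy `thetaFactor H m`. -/
structure IsTheta (Λ : Submodule ℤ V) (J : V →ₗ[ℝ] V) (H : V →L[ℝ] V →L[ℝ] ℂ) (m : ℕ)
    (f : V → ℂ) : Prop where
  contDiff : ContDiff ℝ 1 f
  holomorphic : ∀ z v, fderiv ℝ f z (J v) = Complex.I * fderiv ℝ f z v
  automorphy : ∀ l ∈ Λ, ∀ z, f (z + l) = thetaFactor H m l z * f z

/-- The exponents in the Poincaré series `coherentTheta`. -/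
noncomputable def coherentPhase (H : V →L[ℝ] V →L[ℝ] ℂ) (a z l : V) : ℂ :=
  H a (z + l) - H l z - H l l / 2

/-- The Poincaré series of the entire function `z ↦ exp (2πm H(a, z))`, which for the hermitian
metric `exp (-2πm H(z, z))` is a Gaussian centred at `a`. -/
noncomputable def coherentTheta (Λ : Submodule ℤ V) (H : V →L[ℝ] V →L[ℝ] ℂ) (m : ℕ) (a z : V) :
    ℂ :=
  ∑' l : Λ, Complex.exp (2 * Real.pi * m * coherentPhase H a z l)

variable {Λ : Submodule ℤ V} {J : V →ₗ[ℝ] V} {H : V →L[ℝ] V →L[ℝ] ℂ}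

theorem IsCoercivePolarization.re_symm (hH : IsCoercivePolarization Λ J H) (x y : V) :
    (H x y).re = (H y x).re := by
  rw [hH.conj_symm y x, Complex.conj_re]

theorem IsCoercivePolarization.re_pos (hH : IsCoercivePolarization Λ J H) {x : V} (hx : x ≠ 0) :
    0 < (H x x).re := by
  obtain ⟨c, hc, h⟩ := hH.coercive
  have := norm_pos_iff.mpr hx
  exact lt_of_lt_of_le (by positivity) (h x)

theorem IsCoercivePolarization.self_eq_re (hH : IsCoercivePolarization Λ J H) (x : V) :
    H x x = ((H x x).re : ℂ) :=
  (Complex.conj_eq_iff_re.mp (hH.conj_symm x x).symm).symm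

/-- Away from the peak the exponents are a negative definite quadratic form. -/
theorem IsCoercivePolarization.re_coherentPhase (hH : IsCoercivePolarization Λ J H) (a z l : V) :
    (coherentPhase H a z l).re =
      (H a a).re / 2 + (H z z).re / 2 - (H (z + l - a) (z + l - a)).re / 2 := by
  have h1 := hH.re_symm a z
  have h2 := hH.re_symm a l
  have h3 := hH.re_symm z l
  simp only [coherentPhase, map_add, map_sub, add_apply,
    sub_apply, Complex.add_re, Complex.sub_re, Complex.div_ofNat_re]
  linarith

theorem coherentPhase_re_le {c : ℝ} (hc : ∀ x, c * ‖x‖ ^ 2 ≤ (H x x).re) (a z l : V) :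
    (coherentPhase H a z l).re ≤
      ‖H‖ * ‖a‖ * ‖z‖ + ‖H‖ * (‖a‖ + ‖z‖) * ‖l‖ - c / 2 * ‖l‖ ^ 2 := by
  have h1 := (Complex.re_le_norm _).trans (H.le_opNorm₂ a z)
  have h2 := (Complex.re_le_norm _).trans (H.le_opNorm₂ a l)
  have h3 := (abs_le.mp ((Complex.abs_re_le_norm _).trans (H.le_opNorm₂ l z))).1
  have h4 := hc l
  simp only [coherentPhase, map_add, Complex.add_re, Complex.sub_re, Complex.div_ofNat_re]
  linarith

theorem hasFDerivAt_coherentTerm (m : ℕ) (a l z : V) :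
    HasFDerivAt (fun z ↦ Complex.exp (2 * Real.pi * m * coherentPhase H a z l))
      ((Complex.exp (2 * Real.pi * m * coherentPhase H a z l) * (2 * Real.pi * m)) • H (a - l))
      z := by
  have h : HasFDerivAt (fun z ↦ coherentPhase H a z l) (H (a - l)) z := by
    have h1 : (fun z ↦ coherentPhase H a z l) = fun z ↦ H (a - l) z + (H a l - H l l / 2) := by
      ext z
      simp only [coherentPhase, map_add, map_sub, sub_apply]
      ring
    rw [h1]
    exact (H (a - l)).hasFDerivAt.add_const _
  simpa only [smul_smul] using (h.const_mul (2 * Real.pi * m : ℂ)).cexp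

/-- A summable bound for the differentials of the terms of `coherentTheta` on the ball of
radius `R`. -/
noncomputable def coherentBound (H : V →L[ℝ] V →L[ℝ] ℂ) (c : ℝ) (m : ℕ) (a : V) (R x : ℝ) : ℝ :=
  Real.exp (2 * Real.pi * m * (‖H‖ * ‖a‖ * R + ‖H‖ * (‖a‖ + R) * x - c / 2 * x ^ 2)) *
    (2 * Real.pi * m * (‖H‖ * ((1 + ‖a‖) * (1 + x))))

theorem norm_coherentTerm_le {c : ℝ} (hc : ∀ x, c * ‖x‖ ^ 2 ≤ (H x x).re) (m : ℕ) (a l : V)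
    {R : ℝ} {z : V} (hz : ‖z‖ ≤ R) :
    ‖Complex.exp (2 * Real.pi * m * coherentPhase H a z l)‖ ≤
      Real.exp (2 * Real.pi * m * (‖H‖ * ‖a‖ * R + ‖H‖ * (‖a‖ + R) * ‖l‖ - c / 2 * ‖l‖ ^ 2)) := by
  rw [Complex.norm_exp]
  have : (2 * Real.pi * m * coherentPhase H a z l : ℂ).re =
      2 * Real.pi * m * (coherentPhase H a z l).re := by
    rw [show (2 * Real.pi * m : ℂ) = ((2 * Real.pi * m : ℝ) : ℂ) by push_cast; ring,
      Complex.re_ofReal_mul]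
  rw [this]
  gcongr
  refine (coherentPhase_re_le hc a z l).trans ?_
  gcongr

theorem norm_coherentTerm_fderiv_le {c : ℝ} (hc : ∀ x, c * ‖x‖ ^ 2 ≤ (H x x).re) (m : ℕ) (a l : V)
    {R : ℝ} {z : V} (hz : ‖z‖ ≤ R) :
    ‖(Complex.exp (2 * Real.pi * m * coherentPhase H a z l) * (2 * Real.pi * m)) • H (a - l)‖ ≤
      coherentBound H c m a R ‖l‖ := by
  rw [norm_smul, norm_mul, mul_assoc, coherentBound]
  have h1 : ‖(2 * Real.pi * m : ℂ)‖ = 2 * Real.pi * m := by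
    rw [show (2 * Real.pi * m : ℂ) = ((2 * Real.pi * m : ℝ) : ℂ) by push_cast; ring,
      Complex.norm_real, Real.norm_of_nonneg (by positivity)]
  have h2 : ‖H (a - l)‖ ≤ ‖H‖ * ((1 + ‖a‖) * (1 + ‖l‖)) := by
    refine (H.le_opNorm _).trans ?_
    gcongr
    refine (norm_sub_le _ _).trans ?_
    nlinarith [mul_nonneg (norm_nonneg a) (norm_nonneg l)]
  rw [h1]
  gcongr
  exact norm_coherentTerm_le hc m a l hz

/-- The exponents are compatible with translations by `Λ`; this rests on the integrality
of `Im H`. -/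
theorem IsCoercivePolarization.exp_coherentPhase_add (hH : IsCoercivePolarization Λ J H) (m : ℕ)
    (a z : V) (k l : Λ) :
    Complex.exp (2 * Real.pi * m * coherentPhase H a (z + k) l) =
      thetaFactor H m k z *
        Complex.exp (2 * Real.pi * m * coherentPhase H a z ((l + k : Λ) : V)) := by
  obtain ⟨n, hn⟩ := hH.integral k k.2 l l.2
  have h1 : H k l - H l k = 2 * n * Complex.I := by
    rw [hH.conj_symm k l]
    apply Complex.ext <;> simp [hn]
    ring
  have h2 : 2 * Real.pi * m * coherentPhase H a (z + k) l =
      2 * Real.pi * m * (H k z + H k k / 2) +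
        2 * Real.pi * m * coherentPhase H a z ((l + k : Λ) : V) +
        ((m * n : ℤ) : ℂ) * (2 * Real.pi * Complex.I) := by
    simp only [coherentPhase, map_add, add_apply, Submodule.coe_add]
    push_cast
    linear_combination (Real.pi * m : ℂ) * h1
  rw [h2, Complex.exp_add, Complex.exp_add, Complex.exp_int_mul_two_pi_mul_I, mul_one, thetaFactor]

variable [FiniteDimensional ℝ V] [DiscreteTopology Λ]

variable (Λ) in
theorem summable_coherentExp {c : ℝ} (hc : 0 < c) {m : ℕ} (hm : 0 < m) (D C : ℝ) :
    Summable fun l : Λ ↦ (1 + ‖l‖) *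
      Real.exp (2 * Real.pi * m * (D + C * ‖l‖ - c / 2 * ‖l‖ ^ 2)) := by
  have := (summable_one_add_norm_mul_exp Λ (2 * Real.pi * m * C) (c := 2 * Real.pi * m * (c / 2))
    (by positivity)).mul_left (Real.exp (2 * Real.pi * m * D))
  refine this.congr fun l ↦ ?_
  rw [mul_left_comm, ← Real.exp_add]
  ring_nf

variable (Λ) in
theorem summable_coherentBound {c : ℝ} (hc : 0 < c) {m : ℕ} (hm : 0 < m) (a : V) (R : ℝ) :
    Summable fun l : Λ ↦ coherentBound H c m a R ‖l‖ := by
  have := (summable_coherentExp Λ hc hm (‖H‖ * ‖a‖ * R) (‖H‖ * (‖a‖ + R))).mul_left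
    (2 * Real.pi * m * (‖H‖ * (1 + ‖a‖)))
  refine this.congr fun l ↦ ?_
  rw [coherentBound]
  ring

theorem IsCoercivePolarization.summable_coherentTerm (hH : IsCoercivePolarization Λ J H) {m : ℕ}
    (hm : 0 < m) (a z : V) :
    Summable fun l : Λ ↦ Complex.exp (2 * Real.pi * m * coherentPhase H a z l) := by
  obtain ⟨c, hc0, hc⟩ := hH.coercive
  refine Summable.of_norm_bounded
    (summable_coherentExp Λ hc0 hm (‖H‖ * ‖a‖ * ‖z‖) (‖H‖ * (‖a‖ + ‖z‖))) fun l ↦ ?_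
  refine (norm_coherentTerm_le hc m a l le_rfl).trans ?_
  exact le_mul_of_one_le_left (Real.exp_pos _).le (by simp)

theorem IsCoercivePolarization.summable_coherentTerm_fderiv (hH : IsCoercivePolarization Λ J H)
    {m : ℕ} (hm : 0 < m) (a z : V) :
    Summable fun l : Λ ↦ (Complex.exp (2 * Real.pi * m * coherentPhase H a z l) *
      (2 * Real.pi * m)) • H (a - l) := by
  obtain ⟨c, hc0, hc⟩ := hH.coercive
  exact Summable.of_norm_bounded (summable_coherentBound Λ hc0 hm a ‖z‖) fun l ↦
    norm_coherentTerm_fderiv_le hc m a l le_rfl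

theorem IsCoercivePolarization.hasFDerivAt_coherentTheta (hH : IsCoercivePolarization Λ J H)
    {m : ℕ} (hm : 0 < m) (a z : V) :
    HasFDerivAt (coherentTheta Λ H m a)
      (∑' l : Λ, (Complex.exp (2 * Real.pi * m * coherentPhase H a z l) *
        (2 * Real.pi * m)) • H (a - l)) z := by
  obtain ⟨c, hc0, hc⟩ := hH.coercive
  have hz : z ∈ Metric.ball (0 : V) (‖z‖ + 1) := by simp
  exact hasFDerivAt_tsum_of_isPreconnected (summable_coherentBound Λ hc0 hm a (‖z‖ + 1))
    Metric.isOpen_ball (convex_ball _ _).isPreconnected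
    (fun l w _ ↦ hasFDerivAt_coherentTerm m a l w)
    (fun l w hw ↦ norm_coherentTerm_fderiv_le hc m a l (mem_ball_zero_iff.mp hw).le)
    hz (hH.summable_coherentTerm hm a z) hz

theorem IsCoercivePolarization.fderiv_coherentTheta_apply (hH : IsCoercivePolarization Λ J H)
    {m : ℕ} (hm : 0 < m) (a z v : V) :
    fderiv ℝ (coherentTheta Λ H m a) z v =
      ∑' l : Λ, Complex.exp (2 * Real.pi * m * coherentPhase H a z l) * (2 * Real.pi * m) *
        H (a - l) v := by
  rw [(hH.hasFDerivAt_coherentTheta hm a z).fderiv,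
    ← ContinuousLinearMap.apply_apply (𝕜 := ℝ) v,
    ContinuousLinearMap.map_tsum _ (hH.summable_coherentTerm_fderiv hm a z)]
  rfl

theorem IsCoercivePolarization.contDiff_coherentTheta (hH : IsCoercivePolarization Λ J H)
    {m : ℕ} (hm : 0 < m) (a : V) : ContDiff ℝ 1 (coherentTheta Λ H m a) := by
  rw [contDiff_one_iff_fderiv]
  refine ⟨fun z ↦ (hH.hasFDerivAt_coherentTheta hm a z).differentiableAt, ?_⟩
  obtain ⟨c, hc0, hc⟩ := hH.coercive
  rw [continuous_iff_continuousAt]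
  intro z
  have h : ContinuousOn (fun w ↦ ∑' l : Λ, (Complex.exp (2 * Real.pi * m * coherentPhase H a w l) *
      (2 * Real.pi * m)) • H (a - l)) (Metric.ball (0 : V) (‖z‖ + 1)) := by
    refine continuousOn_tsum (fun l ↦ Continuous.continuousOn ?_)
      (summable_coherentBound (H := H) Λ hc0 hm a (‖z‖ + 1))
      (fun l w hw ↦ norm_coherentTerm_fderiv_le hc m a l (mem_ball_zero_iff.mp hw).le)
    have : Continuous fun w ↦ Complex.exp (2 * Real.pi * m * coherentPhase H a w l) :=
      continuous_iff_continuousAt.mpr fun w ↦ (hasFDerivAt_coherentTerm m a l w).continuousAt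
    fun_prop
  refine (h.continuousAt (Metric.isOpen_ball.mem_nhds (by simp))).congr
    (Filter.Eventually.of_forall fun w ↦ ?_)
  exact (hH.hasFDerivAt_coherentTheta hm a w).fderiv.symm

theorem IsCoercivePolarization.isTheta_coherentTheta (hH : IsCoercivePolarization Λ J H)
    {m : ℕ} (hm : 0 < m) (a : V) : IsTheta Λ J H m (coherentTheta Λ H m a) where
  contDiff := hH.contDiff_coherentTheta hm a
  holomorphic z v := by
    rw [hH.fderiv_coherentTheta_apply hm, hH.fderiv_coherentTheta_apply hm, ← tsum_mul_left]
    refine tsum_congr fun l ↦ ?_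
    rw [hH.map_J]
    ring
  automorphy k hk z := by
    rw [coherentTheta, coherentTheta, ← tsum_mul_left,
      ← (Equiv.addRight (⟨k, hk⟩ : Λ)).tsum_eq fun l : Λ ↦ thetaFactor H m k z * _]
    exact tsum_congr fun l ↦ hH.exp_coherentPhase_add m a z ⟨k, hk⟩ l

end Theta

/-! ### Theta functions of high level separate points and tangent vectors -/

section Separation

variable {V : Type*} [NormedAddCommGroup V] [NormedSpace ℝ V] {Λ : Submodule ℤ V}
  {J : V →ₗ[ℝ] V} {H : V →L[ℝ] V →L[ℝ] ℂ}

theorem exp_mul_coherentTheta (m : ℕ) (a z : V) (w : ℂ) :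
    Complex.exp (-(m * (2 * Real.pi * w))) * coherentTheta Λ H m a z =
      ∑' l : Λ, 1 * Complex.exp (m * (2 * Real.pi * (coherentPhase H a z l - w))) := by
  rw [coherentTheta, ← tsum_mul_left]
  refine tsum_congr fun l ↦ ?_
  rw [← Complex.exp_add, one_mul]
  ring_nf

/-- If `a - z` is small compared with the nonzero lattice vectors, the term `l = 0` dominates
at `z`. -/
theorem IsCoercivePolarization.re_coherentPhase_sub_neg (hH : IsCoercivePolarization Λ J H)
    {a z : V}
    (ha : ∀ l ∈ Λ, (H (a - z) l).re ≤ (H l l).re / 4) {l : Λ} (hl : l ≠ 0) :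
    (2 * Real.pi * (coherentPhase H a z l - H a z)).re < 0 := by
  have h1 := ha l l.2
  have h2 := hH.re_pos (x := (l : V)) (by simpa using hl)
  have h3 := hH.re_symm z l
  rw [show (2 * Real.pi : ℂ) = ((2 * Real.pi : ℝ) : ℂ) by push_cast; ring,
    Complex.re_ofReal_mul]
  refine mul_neg_of_pos_of_neg (by positivity) ?_
  simp only [coherentPhase, map_add, map_sub, sub_apply, Complex.add_re,
    Complex.sub_re, Complex.div_ofNat_re] at h1 ⊢
  linarith

theorem coherentPhase_zero (a z : V) : coherentPhase H a z 0 = H a z := by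
  simp [coherentPhase]

theorem IsCoercivePolarization.re_apply_sub_self_le (hH : IsCoercivePolarization Λ J H) (z : V) :
    ∀ l ∈ Λ, (H (z - z) l).re ≤ (H l l).re / 4 := by
  obtain ⟨c, hc0, hc⟩ := hH.coercive
  intro l _
  have : 0 ≤ (H l l).re := le_trans (by positivity) (hc l)
  simp only [sub_self, map_zero, zero_apply, Complex.zero_re]
  positivity

variable [DiscreteTopology Λ]

theorem IsCoercivePolarization.exists_smul_re_le (hH : IsCoercivePolarization Λ J H) (v : V) :
    ∃ ε : ℝ, 0 < ε ∧ ∀ l ∈ Λ, (H (ε • v) l).re ≤ (H l l).re / 4 := by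
  obtain ⟨c, hc0, hc⟩ := hH.coercive
  obtain ⟨r, hr0, hr⟩ := Metric.isOpen_singleton_iff.mp (isOpen_discrete {(0 : Λ)})
  refine ⟨c * r / (4 * (‖H‖ * ‖v‖ + 1)), by positivity, fun l hl ↦ ?_⟩
  rcases eq_or_ne l 0 with rfl | hl0
  · simp
  have hrl : r ≤ ‖l‖ := by
    by_contra! h
    exact hl0 (congrArg Subtype.val (hr ⟨l, hl⟩ (by simpa [dist_eq_norm] using h)))
  have h1 := (Complex.re_le_norm _).trans (H.le_opNorm₂ v l)
  have h2 := hc l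
  have h3 : c * r / (4 * (‖H‖ * ‖v‖ + 1)) * (‖H‖ * ‖v‖) ≤ c * r / 4 := by
    rw [div_mul_eq_mul_div, div_le_div_iff₀ (by positivity) (by positivity)]
    nlinarith [mul_pos hc0 hr0]
  rw [map_smul, smul_apply, Complex.smul_re, smul_eq_mul]
  calc c * r / (4 * (‖H‖ * ‖v‖ + 1)) * (H v l).re
      ≤ c * r / (4 * (‖H‖ * ‖v‖ + 1)) * (‖H‖ * ‖v‖ * ‖l‖) := by gcongr
    _ = c * r / (4 * (‖H‖ * ‖v‖ + 1)) * (‖H‖ * ‖v‖) * ‖l‖ := by ring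
    _ ≤ c * r / 4 * ‖l‖ := by gcongr
    _ ≤ c * ‖l‖ / 4 * ‖l‖ := by gcongr
    _ ≤ (H l l).re / 4 := by linarith

variable [FiniteDimensional ℝ V]

theorem IsCoercivePolarization.summable_norm_mul_exp (hH : IsCoercivePolarization Λ J H)
    (a z : V) (w : ℂ) {p : Λ → ℂ} {K : ℝ} (hp : ∀ l, ‖p l‖ ≤ K * (1 + ‖l‖)) :
    Summable fun l : Λ ↦ ‖p l‖ * Real.exp (2 * Real.pi * (coherentPhase H a z l - w)).re := by
  obtain ⟨c, hc0, hc⟩ := hH.coercive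
  refine Summable.of_nonneg_of_le (fun l ↦ by positivity) (fun l ↦ ?_)
    ((summable_coherentExp Λ hc0 one_pos (‖H‖ * ‖a‖ * ‖z‖ - w.re)
      (‖H‖ * (‖a‖ + ‖z‖))).mul_left K)
  have h1 : (2 * Real.pi * (coherentPhase H a z l - w)).re =
      2 * Real.pi * ((coherentPhase H a z l).re - w.re) := by
    rw [show (2 * Real.pi : ℂ) = ((2 * Real.pi : ℝ) : ℂ) by push_cast; ring,
      Complex.re_ofReal_mul, Complex.sub_re]
  have h2 := coherentPhase_re_le hc a z l
  rw [← mul_assoc, h1, Nat.cast_one, mul_one, Submodule.coe_norm]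
  have h3 : 0 ≤ K * (1 + ‖(l : V)‖) := (norm_nonneg _).trans (hp l)
  refine mul_le_mul (hp l) (Real.exp_le_exp.mpr ?_) (Real.exp_pos _).le h3
  exact mul_le_mul_of_nonneg_left (by linarith) (by positivity)

theorem IsCoercivePolarization.tendsto_coherentTheta (hH : IsCoercivePolarization Λ J H) {a z : V}
    (ha : ∀ l ∈ Λ, (H (a - z) l).re ≤ (H l l).re / 4) :
    Filter.Tendsto (fun m : ℕ ↦ Complex.exp (-(m * (2 * Real.pi * H a z))) *
      coherentTheta Λ H m a z) Filter.atTop (𝓝 1) := by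
  simp_rw [exp_mul_coherentTheta]
  exact tendsto_tsum_mul_exp_apply (p := fun _ : Λ ↦ (1 : ℂ))
    (hH.summable_norm_mul_exp a z (H a z) (K := 1) (by simp)) 0
    (by simp [coherentPhase_zero]) fun l hl ↦ hH.re_coherentPhase_sub_neg ha hl

theorem IsCoercivePolarization.tendsto_fderiv_coherentTheta (hH : IsCoercivePolarization Λ J H)
    {a z : V} (ha : ∀ l ∈ Λ, (H (a - z) l).re ≤ (H l l).re / 4) (v : V) :
    Filter.Tendsto (fun m : ℕ ↦ Complex.exp (-(m * (2 * Real.pi * H a z))) *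
      (fderiv ℝ (coherentTheta Λ H m a) z v / m)) Filter.atTop (𝓝 (2 * Real.pi * H a v)) := by
  have h := tendsto_tsum_mul_exp_apply (p := fun l : Λ ↦ 2 * Real.pi * H (a - l) v)
    (hH.summable_norm_mul_exp a z (H a z) (K := 2 * Real.pi * (‖H‖ * (1 + ‖a‖) * ‖v‖)) fun l ↦ by
      rw [norm_mul, mul_assoc]
      have h1 : ‖(2 * Real.pi : ℂ)‖ = 2 * Real.pi := by
        rw [show (2 * Real.pi : ℂ) = ((2 * Real.pi : ℝ) : ℂ) by push_cast; ring,
          Complex.norm_real, Real.norm_of_nonneg (by positivity)]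
      rw [h1]
      gcongr
      refine (H.le_opNorm₂ _ _).trans ?_
      have h2 : ‖a - l‖ ≤ (1 + ‖a‖) * (1 + ‖l‖) := by
        refine (norm_sub_le _ _).trans ?_
        rw [Submodule.coe_norm]
        nlinarith [mul_nonneg (norm_nonneg a) (norm_nonneg (l : V))]
      calc ‖H‖ * ‖a - l‖ * ‖v‖ ≤ ‖H‖ * ((1 + ‖a‖) * (1 + ‖l‖)) * ‖v‖ := by gcongr
        _ = _ := by ring) 0
    (by simp [coherentPhase_zero]) fun l hl ↦ hH.re_coherentPhase_sub_neg ha hl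
  simp only [Submodule.coe_zero, sub_zero] at h
  refine h.congr' ((Filter.eventually_gt_atTop 0).mono fun m hm ↦ ?_)
  have hm' : (m : ℂ) ≠ 0 := by exact_mod_cast hm.ne'
  dsimp only
  rw [hH.fderiv_coherentTheta_apply hm, ← tsum_div_const, ← tsum_mul_left]
  refine tsum_congr fun l ↦ ?_
  rw [show (m : ℂ) * (2 * Real.pi * (coherentPhase H a z l - H a z)) =
      -(m * (2 * Real.pi * H a z)) + 2 * Real.pi * m * coherentPhase H a z l by ring,
    Complex.exp_add]
  field_simp

theorem IsCoercivePolarization.tendsto_coherentTheta_zero (hH : IsCoercivePolarization Λ J H)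
    {a z : V} (ha : z - a ∉ Λ) :
    Filter.Tendsto (fun m : ℕ ↦
      Complex.exp (-(m * (2 * Real.pi * (((H a a).re / 2 + (H z z).re / 2 : ℝ) : ℂ)))) *
      coherentTheta Λ H m a z) Filter.atTop (𝓝 0) := by
  simp_rw [exp_mul_coherentTheta]
  refine tendsto_tsum_mul_exp_zero (p := fun _ : Λ ↦ (1 : ℂ))
    (hH.summable_norm_mul_exp a z _ (K := 1) (by simp)) fun l ↦ ?_
  have hne : z + l - a ≠ 0 := fun h ↦ ha (by
    rw [show z - a = -(l : V) by rw [eq_neg_iff_add_eq_zero, ← h]; abel]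
    exact Λ.neg_mem l.2)
  have hpos := hH.re_pos hne
  rw [show (2 * Real.pi : ℂ) = ((2 * Real.pi : ℝ) : ℂ) by push_cast; ring,
    Complex.re_ofReal_mul, Complex.sub_re, hH.re_coherentPhase, Complex.ofReal_re]
  refine mul_neg_of_pos_of_neg (by positivity) (by linarith)

theorem IsCoercivePolarization.exists_isTheta_ne_zero (hH : IsCoercivePolarization Λ J H) (z : V) :
    ∃ m : ℕ, 0 < m ∧ ∃ f, IsTheta Λ J H m f ∧ f z ≠ 0 := by
  have h := (hH.tendsto_coherentTheta (hH.re_apply_sub_self_le z)).eventually_ne one_ne_zero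
  obtain ⟨m, hne, hm⟩ := (h.and (Filter.eventually_gt_atTop 0)).exists
  exact ⟨m, hm, _, hH.isTheta_coherentTheta hm z, right_ne_zero_of_mul hne⟩

/-- Points of `V` that are distinct modulo `Λ` are separated by the Gaussians centred at them. -/
theorem IsCoercivePolarization.exists_isTheta_separating (hH : IsCoercivePolarization Λ J H)
    {z w : V} (hzw : z - w ∉ Λ) :
    ∃ m : ℕ, 0 < m ∧ ∃ f g, IsTheta Λ J H m f ∧ IsTheta Λ J H m g ∧
      f z * g w - f w * g z ≠ 0 := by
  have hwz : w - z ∉ Λ := fun h ↦ hzw (by simpa using Λ.neg_mem h)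
  have h := ((hH.tendsto_coherentTheta (hH.re_apply_sub_self_le z)).mul
    (hH.tendsto_coherentTheta (hH.re_apply_sub_self_le w))).sub
    ((hH.tendsto_coherentTheta_zero hwz).mul (hH.tendsto_coherentTheta_zero hzw))
  obtain ⟨m, hne, hm⟩ := ((h.eventually_ne (by norm_num : (1 * 1 - 0 * 0 : ℂ) ≠ 0)).and
    (Filter.eventually_gt_atTop 0)).exists
  refine ⟨m, hm, _, _, hH.isTheta_coherentTheta hm z, hH.isTheta_coherentTheta hm w,
    fun h0 ↦ hne ?_⟩
  -- both products carry the same normalization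
  rw [mul_mul_mul_comm, mul_mul_mul_comm (Complex.exp _) _ (Complex.exp _), ← Complex.exp_add,
    ← Complex.exp_add]
  have hexp : -((m : ℂ) * (2 * Real.pi * (((H z z).re / 2 + (H w w).re / 2 : ℝ) : ℂ))) +
      -(m * (2 * Real.pi * (((H w w).re / 2 + (H z z).re / 2 : ℝ) : ℂ))) =
      -(m * (2 * Real.pi * H z z)) + -(m * (2 * Real.pi * H w w)) := by
    rw [hH.self_eq_re z, hH.self_eq_re w]
    simp only [Complex.ofReal_re]
    push_cast
    ring
  rw [hexp, ← mul_sub, h0, mul_zero]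

/-- A nonzero tangent vector `v` at `z` is detected by the Gaussians centred at `z` and at
`z + ε v`. -/
theorem IsCoercivePolarization.exists_isTheta_immersive (hH : IsCoercivePolarization Λ J H)
    (z : V) {v : V} (hv : v ≠ 0) :
    ∃ m : ℕ, 0 < m ∧ ∃ f g, IsTheta Λ J H m f ∧ IsTheta Λ J H m g ∧
      f z * fderiv ℝ g z v - g z * fderiv ℝ f z v ≠ 0 := by
  obtain ⟨ε, hε, hpeak⟩ := hH.exists_smul_re_le v
  have ha : ∀ l ∈ Λ, (H (z + ε • v - z) l).re ≤ (H l l).re / 4 := by simpa using hpeak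
  have h := ((hH.tendsto_coherentTheta (hH.re_apply_sub_self_le z)).mul
    (hH.tendsto_fderiv_coherentTheta ha v)).sub
    ((hH.tendsto_coherentTheta ha).mul
      (hH.tendsto_fderiv_coherentTheta (hH.re_apply_sub_self_le z) v))
  have hlim : (1 * (2 * Real.pi * H (z + ε • v) v) - 1 * (2 * Real.pi * H z v) : ℂ) ≠ 0 := by
    have h1 : (1 * (2 * Real.pi * H (z + ε • v) v) - 1 * (2 * Real.pi * H z v) : ℂ) =
        2 * Real.pi * ε * H v v := by
      simp only [map_add, map_smul, add_apply, smul_apply, Complex.real_smul]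
      ring
    rw [h1]
    have h2 : H v v ≠ 0 := fun h ↦ (hH.re_pos hv).ne' (by rw [h, Complex.zero_re])
    have h3 : (Real.pi : ℂ) ≠ 0 := by exact_mod_cast Real.pi_ne_zero
    have h4 : (ε : ℂ) ≠ 0 := by exact_mod_cast hε.ne'
    simp [h2, h3, h4]
  obtain ⟨m, hne, hm⟩ := ((h.eventually_ne hlim).and (Filter.eventually_gt_atTop 0)).exists
  refine ⟨m, hm, _, _, hH.isTheta_coherentTheta hm z, hH.isTheta_coherentTheta hm (z + ε • v),
    fun h0 ↦ hne ?_⟩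
  generalize Complex.exp (-((m : ℂ) * (2 * Real.pi * H z z))) = E₁
  generalize Complex.exp (-((m : ℂ) * (2 * Real.pi * H (z + ε • v) z))) = E₂
  linear_combination E₁ * E₂ / m * h0

end Separation

/-! ### Families of theta functions and change of level -/

section Families

variable {V : Type*} [NormedAddCommGroup V] [NormedSpace ℝ V] {Λ : Submodule ℤ V}
  {J : V →ₗ[ℝ] V} {H : V →L[ℝ] V →L[ℝ] ℂ}

theorem IsTheta.differentiable {m : ℕ} {f : V → ℂ} (hf : IsTheta Λ J H m f) :
    Differentiable ℝ f :=
  hf.contDiff.differentiable one_ne_zero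

theorem fderiv_mul_apply {f g : V → ℂ} {z : V} (hf : DifferentiableAt ℝ f z)
    (hg : DifferentiableAt ℝ g z) (v : V) :
    fderiv ℝ (f * g) z v = f z * fderiv ℝ g z v + fderiv ℝ f z v * g z := by
  rw [fderiv_mul hf hg]
  simp [mul_comm]

theorem IsTheta.mul {m n : ℕ} {f g : V → ℂ} (hf : IsTheta Λ J H m f) (hg : IsTheta Λ J H n g) :
    IsTheta Λ J H (m + n) (f * g) where
  contDiff := hf.contDiff.mul hg.contDiff
  holomorphic z v := by
    rw [fderiv_mul_apply hf.differentiable.differentiableAt hg.differentiable.differentiableAt,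
      fderiv_mul_apply hf.differentiable.differentiableAt hg.differentiable.differentiableAt,
      hf.holomorphic, hg.holomorphic]
    ring
  automorphy l hl z := by
    have h : thetaFactor H (m + n) l z = thetaFactor H m l z * thetaFactor H n l z := by
      rw [thetaFactor, thetaFactor, thetaFactor, ← Complex.exp_add]
      push_cast
      ring_nf
    rw [Pi.mul_apply, Pi.mul_apply, hf.automorphy l hl, hg.automorphy l hl, h]
    ring

theorem IsTheta.pow_mul {m : ℕ} {f g : V → ℂ} (hf : IsTheta Λ J H m f) (hg : IsTheta Λ J H m g)
    (n : ℕ) : IsTheta Λ J H ((n + 1) * m) (f ^ n * g) := by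
  induction n with
  | zero => simpa using hg
  | succ n ih =>
    have h := hf.mul ih
    rwa [← mul_assoc, ← pow_succ', show m + (n + 1) * m = (n + 1 + 1) * m by ring] at h

/-- The products `f ^ n * g` with `f` and `g` in `T`; they define the same map to projective space
as `T` followed by part of a Veronese embedding. -/
def powFamily (T : Set (V → ℂ)) (n : ℕ) : Set (V → ℂ) :=
  Set.image2 (fun f g ↦ f ^ n * g) T T

/-- A finite family of theta functions of level `m`. -/
structure IsThetaFamily (Λ : Submodule ℤ V) (J : V →ₗ[ℝ] V) (H : V →L[ℝ] V →L[ℝ] ℂ) (m : ℕ)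
    (T : Set (V → ℂ)) : Prop where
  pos : 0 < m
  finite : T.Finite
  isTheta : ∀ f ∈ T, IsTheta Λ J H m f

theorem IsThetaFamily.pair {m : ℕ} (hm : 0 < m) {f g : V → ℂ} (hf : IsTheta Λ J H m f)
    (hg : IsTheta Λ J H m g) : IsThetaFamily Λ J H m {f, g} where
  pos := hm
  finite := Set.toFinite _
  isTheta := by rintro _ (rfl | rfl); exacts [hf, hg]

theorem IsThetaFamily.pow {m : ℕ} {T : Set (V → ℂ)} (hT : IsThetaFamily Λ J H m T)
    (n : ℕ) : IsThetaFamily Λ J H ((n + 1) * m) (powFamily T n) where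
  pos := Nat.mul_pos n.succ_pos hT.pos
  finite := hT.finite.image2 _ hT.finite
  isTheta := by
    rintro _ ⟨f, hf, g, hg, rfl⟩
    exact (hT.isTheta f hf).pow_mul (hT.isTheta g hg) n

/-- Two families can be brought to the same level. -/
theorem IsThetaFamily.exists_powFamily_subset {m₁ m₂ : ℕ} {T₁ T₂ : Set (V → ℂ)}
    (h₁ : IsThetaFamily Λ J H m₁ T₁) (h₂ : IsThetaFamily Λ J H m₂ T₂) :
    ∃ m T n₁ n₂, IsThetaFamily Λ J H m T ∧ powFamily T₁ n₁ ⊆ T ∧ powFamily T₂ n₂ ⊆ T := by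
  have h₁' := h₁.pow (m₂ - 1)
  have h₂' := h₂.pow (m₁ - 1)
  rw [Nat.sub_add_cancel h₁.pos] at h₂'
  rw [Nat.sub_add_cancel h₂.pos, mul_comm] at h₁'
  refine ⟨m₁ * m₂, _ ∪ _, _, _, ⟨h₁'.pos, h₁'.finite.union h₂'.finite, ?_⟩,
    Set.subset_union_left, Set.subset_union_right⟩
  rintro f (hf | hf)
  exacts [h₁'.isTheta f hf, h₂'.isTheta f hf]

/-- A property of families that passes to larger families and to higher levels. -/
structure IsLevelStable (Λ : Submodule ℤ V) (J : V →ₗ[ℝ] V) (H : V →L[ℝ] V →L[ℝ] ℂ)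
    (G : Set (V → ℂ) → Prop) : Prop where
  mono : ∀ ⦃S T⦄, S ⊆ T → G S → G T
  pow : ∀ ⦃m T⦄, IsThetaFamily Λ J H m T → ∀ n, G T → G (powFamily T n)

theorem IsLevelStable.of_powFamily_subset {G : Set (V → ℂ) → Prop} (hG : IsLevelStable Λ J H G)
    {m n : ℕ} {S T : Set (V → ℂ)} (hT : IsThetaFamily Λ J H m T) (hS : powFamily T n ⊆ S)
    (h : G T) : G S :=
  hG.mono hS (hG.pow hT n h)

/-- A stable property that holds locally on a compact set, for families of various levels,
holds on the whole set for a single family. -/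
theorem exists_isThetaFamily_of_isCompact {X : Type*} [TopologicalSpace X] {K : Set X}
    (hK : IsCompact K) {G : X → Set (V → ℂ) → Prop} (hG : ∀ x, IsLevelStable Λ J H (G x))
    (hloc : ∀ x ∈ K, ∃ m T, IsThetaFamily Λ J H m T ∧ ∀ᶠ y in 𝓝 x, G y T) :
    ∃ m T, IsThetaFamily Λ J H m T ∧ ∀ x ∈ K, G x T := by
  refine hK.induction_on (p := fun s ↦ ∃ m T, IsThetaFamily Λ J H m T ∧ ∀ x ∈ s, G x T)
    ⟨1, ∅, ⟨one_pos, Set.finite_empty, by simp⟩, by simp⟩ ?_ ?_ ?_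
  · rintro s t hst ⟨m, T, hT, h⟩
    exact ⟨m, T, hT, fun x hx ↦ h x (hst hx)⟩
  · rintro s t ⟨m₁, T₁, hT₁, h₁⟩ ⟨m₂, T₂, hT₂, h₂⟩
    obtain ⟨m, T, n₁, n₂, hT, hs₁, hs₂⟩ := hT₁.exists_powFamily_subset hT₂
    refine ⟨m, T, hT, ?_⟩
    rintro x (hx | hx)
    exacts [(hG x).of_powFamily_subset hT₁ hs₁ (h₁ x hx),
      (hG x).of_powFamily_subset hT₂ hs₂ (h₂ x hx)]
  · intro x hx
    obtain ⟨m, T, hT, h⟩ := hloc x hx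
    exact ⟨_, nhdsWithin_le_nhds h, m, T, hT, fun y hy ↦ hy⟩

/-- `z` is not a base point of `T`. -/
def NonvanishingAt (T : Set (V → ℂ)) (z : V) : Prop :=
  ∃ f ∈ T, f z ≠ 0

/-- The map to projective space given by `T` is defined at `z` and its differential does not
kill `v`. -/
def ImmersiveAt (T : Set (V → ℂ)) (z v : V) : Prop :=
  NonvanishingAt T z ∧ ∀ c : ℂ, ¬ ∀ f ∈ T, fderiv ℝ f z v = c * f z

/-- The map to projective space given by `T` is defined at `z` and, unless `z` and `w` agree
modulo `Λ`, takes different values at `z` and `w`. -/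
def SeparatesAt (Λ : Submodule ℤ V) (T : Set (V → ℂ)) (z w : V) : Prop :=
  NonvanishingAt T z ∧ ∀ c : ℂ, (∀ f ∈ T, f z = c * f w) → z - w ∈ Λ

theorem NonvanishingAt.mono {W : Type*} {S T : Set (W → ℂ)} (hST : S ⊆ T) {z : W} :
    NonvanishingAt S z → NonvanishingAt T z :=
  fun ⟨f, hf, h⟩ ↦ ⟨f, hST hf, h⟩

theorem isLevelStable_nonvanishingAt (z : V) :
    IsLevelStable Λ J H fun T ↦ NonvanishingAt T z where
  mono := fun _ _ hST ↦ NonvanishingAt.mono hST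
  pow := fun _ _ _ n ⟨f, hf, h⟩ ↦ ⟨f ^ n * f, ⟨f, hf, f, hf, rfl⟩, by simp [h]⟩

theorem isLevelStable_immersiveAt (z v : V) :
    IsLevelStable Λ J H fun T ↦ ImmersiveAt T z v where
  mono := fun _ _ hST ⟨h0, h⟩ ↦ ⟨h0.mono hST, fun c hc ↦ h c fun f hf ↦ hc f (hST hf)⟩
  pow := by
    rintro m T hT n ⟨h0, h⟩
    refine ⟨(isLevelStable_nonvanishingAt z).pow hT n h0, fun c hc ↦ ?_⟩
    obtain ⟨f, hf, hfz⟩ := h0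
    have hPz : (f ^ n) z ≠ 0 := by simpa using pow_ne_zero n hfz
    have hP : DifferentiableAt ℝ (f ^ n) z :=
      ((hT.isTheta f hf).differentiable.pow n).differentiableAt
    refine h (c - fderiv ℝ (f ^ n) z v / (f ^ n) z) fun g hg ↦ ?_
    have h1 := hc _ ⟨f, hf, g, hg, rfl⟩
    dsimp only at h1
    rw [fderiv_mul_apply hP (hT.isTheta g hg).differentiable.differentiableAt,
      Pi.mul_apply] at h1
    field_simp
    linear_combination h1

theorem ImmersiveAt.smul {T : Set (V → ℂ)} {z v : V} (h : ImmersiveAt T z v) {r : ℝ}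
    (hr : r ≠ 0) : ImmersiveAt T z (r • v) := by
  refine ⟨h.1, fun c hc ↦ h.2 (c / r) fun f hf ↦ ?_⟩
  have h1 := hc f hf
  have hr' : (r : ℂ) ≠ 0 := by exact_mod_cast hr
  rw [map_smul, Complex.real_smul] at h1
  field_simp
  linear_combination h1

theorem isLevelStable_separatesAt (z w : V) :
    IsLevelStable Λ J H fun T ↦ SeparatesAt Λ T z w where
  mono := fun _ _ hST ⟨h0, h⟩ ↦ ⟨h0.mono hST, fun c hc ↦ h c fun f hf ↦ hc f (hST hf)⟩
  pow := by
    rintro m T hT n ⟨h0, h⟩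
    refine ⟨(isLevelStable_nonvanishingAt z).pow hT n h0, fun c hc ↦ ?_⟩
    obtain ⟨f, hf, hfz⟩ := h0
    refine h (c * f w ^ n / f z ^ n) fun g hg ↦ ?_
    have h1 := hc _ ⟨f, hf, g, hg, rfl⟩
    simp only [Pi.mul_apply, Pi.pow_apply] at h1
    field_simp
    linear_combination h1

/-! ### Translation by lattice vectors -/

theorem thetaFactor_ne_zero (m : ℕ) (l z : V) : thetaFactor H m l z ≠ 0 :=
  Complex.exp_ne_zero _

theorem differentiable_thetaFactor (m : ℕ) (l : V) : Differentiable ℝ (thetaFactor H m l) := by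
  unfold thetaFactor
  fun_prop

theorem IsThetaFamily.nonvanishingAt_add {m : ℕ} {T : Set (V → ℂ)}
    (hT : IsThetaFamily Λ J H m T) {z l : V} (hl : l ∈ Λ) (h : NonvanishingAt T z) :
    NonvanishingAt T (z + l) := by
  obtain ⟨f, hf, hz⟩ := h
  refine ⟨f, hf, ?_⟩
  rw [(hT.isTheta f hf).automorphy l hl]
  exact mul_ne_zero (thetaFactor_ne_zero m l z) hz

theorem IsThetaFamily.immersiveAt_add {m : ℕ} {T : Set (V → ℂ)}
    (hT : IsThetaFamily Λ J H m T) {z l v : V} (hl : l ∈ Λ) (h : ImmersiveAt T z v) :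
    ImmersiveAt T (z + l) v := by
  refine ⟨hT.nonvanishingAt_add hl h.1, fun c hc ↦ ?_⟩
  have he := thetaFactor_ne_zero (H := H) m l z
  refine h.2 (c - fderiv ℝ (thetaFactor H m l) z v / thetaFactor H m l z) fun f hf ↦ ?_
  have h1 := hc f hf
  have h2 : (fun y ↦ f (y + l)) = thetaFactor H m l * f :=
    funext fun y ↦ (hT.isTheta f hf).automorphy l hl y
  rw [← fderiv_comp_add_right, h2, fderiv_mul_apply (differentiable_thetaFactor m l _)
    (hT.isTheta f hf).differentiable.differentiableAt, (hT.isTheta f hf).automorphy l hl] at h1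
  field_simp
  linear_combination h1

theorem IsThetaFamily.separatesAt_add {m : ℕ} {T : Set (V → ℂ)}
    (hT : IsThetaFamily Λ J H m T) {z w k l : V} (hk : k ∈ Λ) (hl : l ∈ Λ)
    (h : SeparatesAt Λ T z w) : SeparatesAt Λ T (z + k) (w + l) := by
  refine ⟨hT.nonvanishingAt_add hk h.1, fun c hc ↦ ?_⟩
  have he := thetaFactor_ne_zero (H := H) m k z
  have h1 := h.2 (c * thetaFactor H m l w / thetaFactor H m k z) fun f hf ↦ by
    have h2 := hc f hf
    rw [(hT.isTheta f hf).automorphy k hk, (hT.isTheta f hf).automorphy l hl] at h2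
    field_simp
    linear_combination h2
  rw [show z + k - (w + l) = z - w + (k - l) by abel]
  exact Λ.add_mem h1 (Λ.sub_mem hk hl)

/-! ### Immersions are locally injective -/

/-- Near the diagonal, a family that is immersive at `z` separates points. -/
theorem IsThetaFamily.eventually_eq_of_proportional [FiniteDimensional ℝ V] {m : ℕ}
    {T : Set (V → ℂ)} (hT : IsThetaFamily Λ J H m T) {z : V} (h0 : NonvanishingAt T z)
    (h : ∀ v, v ≠ 0 → ImmersiveAt T z v) :
    ∀ᶠ p in 𝓝 (z, z), NonvanishingAt T p.1 ∧
      ∀ c : ℂ, (∀ f ∈ T, f p.1 = c * f p.2) → p.1 = p.2 := by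
  obtain ⟨f₀, hf₀, hz⟩ := h0
  have := hT.finite.fintype
  -- affine coordinates in the chart of projective space where the coordinate `f₀` is nonzero
  set G : V → T → ℂ := fun y f ↦ f.1 y / f₀ y with hG
  have hd : ∀ f ∈ T, DifferentiableAt ℝ f z := fun f hf ↦
    (hT.isTheta f hf).differentiable.differentiableAt
  have hGc : ContDiffAt ℝ 1 G z := contDiffAt_pi.mpr fun f ↦ by
    simp_rw [hG, div_eq_mul_inv]
    exact (hT.isTheta f f.2).contDiff.contDiffAt.mul
      ((hT.isTheta f₀ hf₀).contDiff.contDiffAt.inv hz)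
  have hGs : HasStrictFDerivAt G (fderiv ℝ G z) z := hGc.hasStrictFDerivAt one_ne_zero
  have hinj : Function.Injective (fderiv ℝ G z) := by
    rw [injective_iff_map_eq_zero]
    intro v hv
    by_contra hv0
    refine (h v hv0).2 (fderiv ℝ f₀ z v / f₀ z) fun f hf ↦ ?_
    have hGd := hGs.hasFDerivAt.differentiableAt
    have hr : DifferentiableAt ℝ (fun y ↦ G y ⟨f, hf⟩) z := differentiableAt_pi.mp hGd ⟨f, hf⟩
    have h1 : fderiv ℝ (fun y ↦ G y ⟨f, hf⟩) z v = 0 := by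
      rw [fderiv_apply hGd]
      exact congrFun hv ⟨f, hf⟩
    have h2 : (fun y ↦ G y ⟨f, hf⟩) * f₀ =ᶠ[𝓝 z] f :=
      ((hd f₀ hf₀).continuousAt.eventually_ne hz).mono fun y hy ↦ div_mul_cancel₀ (f y) hy
    rw [← h2.fderiv_eq, fderiv_mul_apply hr (hd f₀ hf₀), h1]
    simp only [hG]
    ring
  obtain ⟨L, hL⟩ := (fderiv ℝ G z : V →ₗ[ℝ] T → ℂ).exists_leftInverse_of_injective
    (LinearMap.ker_eq_bot.mpr hinj)
  have hLG : HasStrictFDerivAt (fun y ↦ L.toContinuousLinearMap (G y))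
      ((ContinuousLinearEquiv.refl ℝ V : V ≃L[ℝ] V) : V →L[ℝ] V) z := by
    have h1 := L.toContinuousLinearMap.hasStrictFDerivAt.comp z hGs
    convert h1 using 1
    ext v
    exact (LinearMap.congr_fun hL v).symm
  have hsrc := hLG.toOpenPartialHomeomorph.open_source.mem_nhds
    hLG.mem_toOpenPartialHomeomorph_source
  have hne : ∀ᶠ y in 𝓝 z, f₀ y ≠ 0 :=
    (hd f₀ hf₀).continuousAt.eventually_ne hz
  rw [nhds_prod_eq]
  filter_upwards [((Filter.eventually_mem_set.mpr hsrc).and hne).prod_mk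
    ((Filter.eventually_mem_set.mpr hsrc).and hne)] with p ⟨⟨hp1, hn1⟩, hp2, hn2⟩
  refine ⟨⟨f₀, hf₀, hn1⟩, fun c hc ↦ ?_⟩
  refine hLG.toOpenPartialHomeomorph.injOn hp1 hp2 ?_
  rw [hLG.toOpenPartialHomeomorph_coe]
  refine congrArg _ (funext fun f ↦ ?_)
  have hc0 : c ≠ 0 := fun h ↦ hn1 (by rw [hc f₀ hf₀, h, zero_mul])
  simp only [hG]
  rw [hc f f.2, hc f₀ hf₀, mul_div_mul_left _ _ hc0]

end Families

/-! ### The projective embedding -/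

section Embedding

variable {V : Type*} [NormedAddCommGroup V] [NormedSpace ℝ V] [FiniteDimensional ℝ V]
  {Λ : Submodule ℤ V} [DiscreteTopology Λ] {J : V →ₗ[ℝ] V} {H : V →L[ℝ] V →L[ℝ] ℂ}

/-- The translates of some compact set by `Λ` cover `V`. -/
theorem exists_isCompact_add_mem (Λ : Submodule ℤ V) [DiscreteTopology Λ] [IsZLattice ℝ Λ] :
    ∃ K : Set V, IsCompact K ∧ ∀ z, ∃ k ∈ K, ∃ l ∈ Λ, z = k + l := by
  have := ZLattice.module_free ℝ Λ
  have := ZLattice.module_finite ℝ Λ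
  let b := (Module.Free.chooseBasis ℤ Λ).ofZLatticeBasis ℝ
  have : Fintype (Module.Free.ChooseBasisIndex ℤ Λ) := inferInstance
  refine ⟨closure (ZSpan.fundamentalDomain b),
    (ZSpan.fundamentalDomain_isBounded b).isCompact_closure, fun z ↦
    ⟨ZSpan.fract b z, subset_closure (ZSpan.fract_mem_fundamentalDomain b z), ZSpan.floor b z, ?_,
      by rw [ZSpan.fract_apply, sub_add_cancel]⟩⟩
  exact (Module.Basis.ofZLatticeBasis_span ℝ Λ (Module.Free.chooseBasis ℤ Λ)).le
    (ZSpan.floor b z).2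

variable [IsZLattice ℝ Λ]

/-- Some finite family of theta functions defines an immersion of `V` in projective space. -/
theorem IsCoercivePolarization.exists_immersive (hH : IsCoercivePolarization Λ J H) :
    ∃ m T, IsThetaFamily Λ J H m T ∧ (∀ z, NonvanishingAt T z) ∧
      ∀ z v, v ≠ 0 → ImmersiveAt T z v := by
  obtain ⟨K, hK, hKΛ⟩ := exists_isCompact_add_mem Λ
  obtain ⟨m₁, T₁, hT₁, h₁⟩ := exists_isThetaFamily_of_isCompact (Λ := Λ) (J := J) (H := H) hK
    isLevelStable_nonvanishingAt fun z _ ↦ by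
      obtain ⟨m, hm, f, hf, hz⟩ := hH.exists_isTheta_ne_zero z
      refine ⟨m, {f, f}, .pair hm hf hf, ?_⟩
      filter_upwards [hf.contDiff.continuous.continuousAt.eventually_ne hz] with y hy
      exact ⟨f, by simp, hy⟩
  obtain ⟨m₂, T₂, hT₂, h₂⟩ := exists_isThetaFamily_of_isCompact (Λ := Λ) (J := J) (H := H)
    (hK.prod (isCompact_sphere (0 : V) 1)) (G := fun p T ↦ ImmersiveAt T p.1 p.2)
    (fun p ↦ isLevelStable_immersiveAt p.1 p.2) fun ⟨z, v⟩ hp ↦ by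
      have hv : v ≠ 0 := ne_zero_of_mem_unit_sphere (⟨v, hp.2⟩ : Metric.sphere (0 : V) 1)
      obtain ⟨m, hm, f, g, hf, hg, hfg⟩ := hH.exists_isTheta_immersive z hv
      refine ⟨m, {f, g}, .pair hm hf hg, ?_⟩
      have hc : Continuous fun p : V × V ↦
          f p.1 * fderiv ℝ g p.1 p.2 - g p.1 * fderiv ℝ f p.1 p.2 :=
        ((hf.contDiff.continuous.comp continuous_fst).mul
          (hg.contDiff.continuous_fderiv_apply one_ne_zero)).sub
        ((hg.contDiff.continuous.comp continuous_fst).mul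
          (hf.contDiff.continuous_fderiv_apply one_ne_zero))
      filter_upwards [hc.continuousAt.eventually_ne hfg] with p hp
      refine ⟨?_, fun c hc ↦ hp ?_⟩
      · by_contra hn
        simp only [NonvanishingAt, Set.mem_insert_iff, Set.mem_singleton_iff, exists_eq_or_imp,
          exists_eq_left, not_or, not_not] at hn
        exact hp (by rw [hn.1, hn.2]; ring)
      · rw [hc f (by simp), hc g (by simp)]
        ring
  obtain ⟨m, T, n₁, n₂, hT, hs₁, hs₂⟩ := hT₁.exists_powFamily_subset hT₂
  refine ⟨m, T, hT, fun z ↦ ?_, fun z v hv ↦ ?_⟩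
  · obtain ⟨k, hk, l, hl, rfl⟩ := hKΛ z
    exact hT.nonvanishingAt_add hl
      ((isLevelStable_nonvanishingAt k).of_powFamily_subset hT₁ hs₁ (h₁ k hk))
  · obtain ⟨k, hk, l, hl, rfl⟩ := hKΛ z
    have hv' : ‖v‖ ≠ 0 := norm_ne_zero_iff.mpr hv
    have h := h₂ (k, ‖v‖⁻¹ • v) ⟨hk, by simp [norm_smul, hv']⟩
    have h' := hT.immersiveAt_add hl
      ((isLevelStable_immersiveAt k _).of_powFamily_subset hT₂ hs₂ h)
    simpa [smul_smul, hv'] using h'.smul hv'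

/-- Some finite family of theta functions defines an embedding of the torus in projective space. -/
theorem IsCoercivePolarization.exists_embedding (hH : IsCoercivePolarization Λ J H) :
    ∃ m T, IsThetaFamily Λ J H m T ∧ (∀ z v, v ≠ 0 → ImmersiveAt T z v) ∧
      ∀ z w, SeparatesAt Λ T z w := by
  obtain ⟨K, hK, hKΛ⟩ := exists_isCompact_add_mem Λ
  obtain ⟨m₁, T₁, hT₁, h₀, h₁⟩ := hH.exists_immersive
  obtain ⟨m₂, T₂, hT₂, h₂⟩ := exists_isThetaFamily_of_isCompact (Λ := Λ) (J := J) (H := H)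
    (hK.prod hK) (G := fun p T ↦ SeparatesAt Λ T p.1 p.2)
    (fun p ↦ isLevelStable_separatesAt p.1 p.2) fun ⟨z, w⟩ _ ↦ by
      by_cases hzw : z - w ∈ Λ
      · refine ⟨m₁, T₁, hT₁, ?_⟩
        have hc : Filter.Tendsto (fun p : V × V ↦ (p.1, p.2 + (z - w))) (𝓝 (z, w)) (𝓝 (z, z)) :=
          Continuous.tendsto' (by fun_prop) _ _ (by simp)
        filter_upwards [hc.eventually
          (hT₁.eventually_eq_of_proportional (h₀ z) (h₁ z))] with p ⟨hp0, hp⟩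
        have h : SeparatesAt Λ T₁ p.1 (p.2 + (z - w)) :=
          ⟨hp0, fun c hc ↦ by rw [hp c hc, sub_self]; exact Λ.zero_mem⟩
        simpa only [add_zero, add_neg_cancel_right] using
          hT₁.separatesAt_add Λ.zero_mem (Λ.neg_mem hzw) h
      · obtain ⟨m, hm, f, g, hf, hg, hfg⟩ := hH.exists_isTheta_separating hzw
        refine ⟨m, {f, g}, .pair hm hf hg, ?_⟩
        have hfc := hf.contDiff.continuous
        have hgc := hg.contDiff.continuous
        have hc : Continuous fun p : V × V ↦ f p.1 * g p.2 - f p.2 * g p.1 := by fun_prop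
        filter_upwards [hc.continuousAt.eventually_ne hfg] with p hp
        refine ⟨?_, fun c hc ↦ (hp ?_).elim⟩
        · by_contra hn
          simp only [NonvanishingAt, Set.mem_insert_iff, Set.mem_singleton_iff, exists_eq_or_imp,
            exists_eq_left, not_or, not_not] at hn
          exact hp (by rw [hn.1, hn.2]; ring)
        · rw [hc f (by simp), hc g (by simp)]
          ring
  obtain ⟨m, T, n₁, n₂, hT, hs₁, hs₂⟩ := hT₁.exists_powFamily_subset hT₂
  refine ⟨m, T, hT, fun z v hv ↦
    (isLevelStable_immersiveAt z v).of_powFamily_subset hT₁ hs₁ (h₁ z v hv), fun z w ↦ ?_⟩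
  obtain ⟨k, hk, l, hl, rfl⟩ := hKΛ z
  obtain ⟨k', hk', l', hl', rfl⟩ := hKΛ w
  exact hT.separatesAt_add hl hl'
    ((isLevelStable_separatesAt k k').of_powFamily_subset hT₂ hs₂ (h₂ (k, k') ⟨hk, hk'⟩))

theorem IsCoercivePolarization.isAbelianVariety (hH : IsCoercivePolarization Λ J H)
    (hJ : IsComplexStructure J) : IsAbelianVariety Λ J := by
  obtain ⟨m, T, hT, him, hsep⟩ := hH.exists_embedding
  obtain ⟨n, ⟨e⟩⟩ : ∃ n, Nonempty (Fin (n + 1) ≃ T) := by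
    have := hT.finite.fintype
    obtain ⟨f, hf, -⟩ := (hsep 0 0).1
    have hpos : 0 < Fintype.card T := Fintype.card_pos_iff.mpr ⟨⟨f, hf⟩⟩
    exact ⟨Fintype.card T - 1, ⟨(Fintype.equivFinOfCardEq (by omega)).symm⟩⟩
  set F : V → Fin (n + 1) → ℂ := fun z i ↦ (e i).1 z with hF
  have hall : ∀ {P : (V → ℂ) → Prop}, (∀ i, P (e i).1) → ∀ f ∈ T, P f := fun h f hf ↦ by
    simpa using h (e.symm ⟨f, hf⟩)
  have hF0 : ∀ z, F z ≠ 0 := fun z h ↦ by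
    obtain ⟨f, hf, hz⟩ := (hsep z z).1
    exact hz (hall (P := fun f ↦ f z = 0) (congrFun h) f hf)
  have hFd : ∀ z i, DifferentiableAt ℝ (fun w ↦ F w i) z := fun z i ↦
    (hT.isTheta _ (e i).2).differentiable.differentiableAt
  have hFd' : ∀ z, DifferentiableAt ℝ F z := fun z ↦ differentiableAt_pi.mpr (hFd z)
  have hFf : ∀ z v i, fderiv ℝ F z v i = fderiv ℝ (e i).1 z v := fun z v i ↦ by
    have := fderiv_apply (hFd' z) i
    exact (congrArg (fun L : V →L[ℝ] ℂ ↦ L v) this).symm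
  have hsurj := Submodule.mkQ_surjective Λ
  let s : V ⧸ Λ → V := Function.surjInv hsurj
  have hs : ∀ x, Submodule.Quotient.mk (s x) = x := Function.surjInv_eq hsurj
  have hφ : ∀ w, Projectivization.mk ℂ (F (s (Submodule.Quotient.mk w))) (hF0 _) =
      Projectivization.mk ℂ (F w) (hF0 w) := fun w ↦ by
    have hl : s (Submodule.Quotient.mk w) - w ∈ Λ :=
      (Submodule.Quotient.eq Λ).mp (hs (Submodule.Quotient.mk w))
    rw [Projectivization.mk_eq_mk_iff']
    refine ⟨thetaFactor H m (s (Submodule.Quotient.mk w) - w) w, funext fun i ↦ ?_⟩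
    have h := (hT.isTheta _ (e i).2).automorphy _ hl w
    rw [add_sub_cancel] at h
    exact h.symm
  refine ⟨hJ, n, fun x ↦ Projectivization.mk ℂ (F (s x)) (hF0 _), fun x y hxy ↦ ?_, fun z ↦
    ⟨Set.univ, isOpen_univ, Set.mem_univ z, F, fun w _ ↦ ⟨hFd' w, fun v ↦ ?_⟩,
      fun w _ ↦ ⟨hF0 w, hφ w⟩, ?_⟩⟩
  · obtain ⟨c, hc⟩ := (Projectivization.mk_eq_mk_iff' ℂ _ _ _ _).mp hxy
    have h := (hsep (s x) (s y)).2 c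
      (hall (P := fun f ↦ f (s x) = c * f (s y)) fun i ↦ (congrFun hc i).symm)
    rw [← hs x, ← hs y]
    exact (Submodule.Quotient.eq Λ).mpr h
  · ext i
    rw [hFf, Pi.smul_apply, hFf, smul_eq_mul]
    exact (hT.isTheta _ (e i).2).holomorphic w v
  · rintro v ⟨c, hc⟩
    by_contra hv
    refine (him z v hv).2 c (hall (P := fun f ↦ fderiv ℝ f z v = c * f z) fun i ↦ ?_)
    rw [← hFf, hc]
    rfl

end Embedding

/-- A positive definite quadratic form on a finite dimensional space is bounded below by a positive
multiple of the square of the norm. -/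
theorem exists_mul_norm_sq_le {V : Type*} [NormedAddCommGroup V] [NormedSpace ℝ V]
    [FiniteDimensional ℝ V] (B : V →L[ℝ] V →L[ℝ] ℝ) (hB : ∀ x, x ≠ 0 → 0 < B x x) :
    ∃ c > 0, ∀ x, c * ‖x‖ ^ 2 ≤ B x x := by
  obtain ⟨c, hc, h⟩ : ∃ c > 0, ∀ x ∈ Metric.sphere (0 : V) 1, c ≤ B x x := by
    rcases (Metric.sphere (0 : V) 1).eq_empty_or_nonempty with h | hne
    · exact ⟨1, one_pos, by simp [h]⟩
    · obtain ⟨x, hx, hmin⟩ := (isCompact_sphere (0 : V) 1).exists_isMinOn hne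
        (f := fun x ↦ B x x) (by fun_prop)
      exact ⟨B x x, hB x (ne_zero_of_mem_unit_sphere ⟨x, hx⟩), fun y hy ↦ hmin hy⟩
  refine ⟨c, hc, fun x ↦ ?_⟩
  rcases eq_or_ne x 0 with rfl | hx
  · simp
  have hx' : ‖x‖ ≠ 0 := norm_ne_zero_iff.mpr hx
  have h1 := h (‖x‖⁻¹ • x) (by simp [norm_smul, hx'])
  simp only [map_smul, smul_apply, smul_eq_mul] at h1
  have h2 : B x x = ‖x‖ ^ 2 * (‖x‖⁻¹ * (‖x‖⁻¹ * B x x)) := by field_simp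
  rw [h2, mul_comm]
  gcongr

/-- A polarized complex torus is an abelian variety. -/
theorem IsPolarization.isAbelianVariety {V : Type*} [NormedAddCommGroup V] [NormedSpace ℝ V]
    [FiniteDimensional ℝ V] {Λ : Submodule ℤ V} [DiscreteTopology Λ] [IsZLattice ℝ Λ]
    {J : V →ₗ[ℝ] V} {h : V →ₗ[ℝ] V →ₗ[ℝ] ℂ} (hh : IsPolarization Λ J h) :
    IsAbelianVariety Λ J := by
  have hH : IsCoercivePolarization Λ J h.toContinuousBilinearMap :=
    { conj_symm := hh.hermitian.conj_symm
      map_J := hh.hermitian.map_J_right hh.complex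
      coercive := exists_mul_norm_sq_le (rePart h).toContinuousBilinearMap
        hh.hermitian.re_isMetric.pos
      integral := hh.integral }
  exact hH.isAbelianVariety hh.complex

theorem corollary5p4 {V : Type*} [NormedAddCommGroup V] [NormedSpace ℝ V]
    [FiniteDimensional ℝ V] (Λ : Submodule ℤ V) [DiscreteTopology Λ] [IsZLattice ℝ Λ]
    (ω : LinearMap.BilinForm ℝ V) (hω : IsSymplecticForm ω) (hint : IsIntegralOn Λ ω) :
    (∀ b : LinearMap.BilinForm ℝ V, IsMetric b →
      (∃! J : V →ₗ[ℝ] V, IsAssociatedComplexStructure b ω J) ∧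
      ∀ J : V →ₗ[ℝ] V, IsAssociatedComplexStructure b ω J →
        IsAbelianVariety Λ J ∧
        IsPolarization Λ J (complexForm ω J) ∧
        (IsUnimodularOn Λ ω → IsPrincipal Λ (complexForm ω J))) ∧
    (∀ J : V →ₗ[ℝ] V, IsComplexStructure J → IsTamedBy ω J →
      IsRiemannForm Λ J ω ∧
      IsMetric (realForm ω J) ∧
      ∀ J' : V →ₗ[ℝ] V, IsAssociatedComplexStructure (realForm ω J) ω J' ↔ J' = J) := by
  refine ⟨fun b hb ↦ ⟨existsUnique_isAssociatedComplexStructure hb hω, fun J hJ ↦ ?_⟩,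
    fun J hJ ht ↦ ?_⟩
  · have hpol : IsPolarization Λ J (complexForm ω J) :=
      ⟨hJ.complex, hJ.isHermitianMetric hω, by rwa [imPart_complexForm]⟩
    exact ⟨hpol.isAbelianVariety, hpol,
      fun hun ↦ isPrincipal_of_isUnimodularOn hω hun (imPart_complexForm ω J)⟩
  · have h := ht.isAssociatedComplexStructure hω hJ
    refine ⟨⟨hω.skew, hint, ht.compatible, h.isMetric, h.metric_inv⟩, h.isMetric, fun J' ↦
      ⟨fun h' ↦ ?_, fun h' ↦ h' ▸ h⟩⟩
    exact (existsUnique_isAssociatedComplexStructure h.isMetric hω).unique h' h
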